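/- Let $d,\alpha\ge 1$ be integers and let $N$ be a prime. **Korobov space on the box.** For $a>0$ and $h\in\mathbb Z^d$ put $\varphi_{a,d,h}(x)=\prod_{j=1}^d\frac1{\sqrt{2a}}\exp\left(2\pi i h_j\frac{x_j+a}{2a}\right)$, $\widehat\phi_{a,d}(h)=\int_{[-a,a]^d}\phi\,\overline{\varphi_{a,d,h}}\,dx$ and $r_{\alpha,a,d}(h)=\prod_j r_{\alpha,a}(h_j)$, where $r_{\alpha,a}(0)=\sqrt{2a}$ and $r_{\alpha,a}(k)=|\pi k/a|^\alpha$ for $k\ne0$. The space $\mathcal H(K_{\alpha,a,d})$ consists of the (real- or complex-valued) functions $\phi$ on $[-a,a]^d$ that equal at every point the sum of their absolutely convergent Fourier series $\sum_h\widehat\phi_{a,d}(h)\varphi_{a,d,h}$ and satisfy $\|\phi\|_{K_{\alpha,a,d}}^2=\sum_h|\widehat\phi_{a,d}(h)|^2r_{\alpha,a,d}(h)^2<\infty$. **Lattice algorithm.** Put $r_{\alpha,d}(h)=\prod_j r_\alpha(h_j)$ with $r_\alpha(0)=1$ and $r_\alpha(k)=|2\pi k|^\alpha$ for $k\neq0$.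 For $z\in\{1,\dots,N-1\}^d$ put $$S(z)=\sum_{h\in\mathbb Z^d}\ \sum_{\substack{\ell\in\mathbb Z^d\setminus\{0\}\\ \ell\cdot z\equiv0\ (\mathrm{mod}\ N)}}\frac1{r_{\alpha,d}(h)^2\,r_{\alpha,d}(h+\ell)^2},$$ and for $1\le s\le d$ let $T_s(z_1,\dots,z_s)$ be the part of this sum with $\ell_s\neq0$ and $\ell_j=0$ for all $j>s$. A generating vector $z^*$ is produced by the component-by-component (CBC) construction if, for $s=1,\dots,d$ in turn, $z_s^*$ minimizes $c\mapsto T_s(z_1^*,\dots,z_{s-1}^*,c)$ over $\{1,\dots,N-1\}$. Let $y_k^*=\{kz^*/N\}$ (componentwise fractional part), $k=1,\dots,N$, $M=S(z^*)^{-1/2}$, and $$B_N^*(f)(y)=\sum_{h:\ r_{\alpha,d}(h)^2\le M}\Big(\frac1N\sum_{k=1}^N f(y_k^*)e^{-2\pi i\langle h,y_k^*\rangle}\Big)e^{2\pi i\langle h,y\rangle}.$$ With $\mathcal J_a(y)=2ay-(a,\dots,a)$, which maps $[0,1]^d$ onto $[-a,a]^d$, let $A_N^*(\phi)=B_N^*(\phi\circ\mathcal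 J_a)\circ\mathcal J_a^{-1}$. **Constant.** For $0<\delta<\alpha/2$ let $$C_{\alpha,\delta,d}=\sqrt2\,\max\left\{6,\ 2.5+2^{\frac{2\alpha}{\alpha-2\delta}+1}\right\}^{\alpha/2-\delta}\left(\sum_{u\subset\{1,\dots,d\}}\max(|u|,1)\left[2\left(\tfrac1{2\pi}\right)^{\frac{\alpha}{\alpha-2\delta}}\zeta\left(\tfrac{\alpha}{\alpha-2\delta}\right)\right]^{|u|}\right)^{\alpha-2\delta}.$$ **Proposition.** A vector $z^*$ produced by the CBC construction exists, and for every such $z^*$, every $a\ge\frac12$, every $\phi\in\mathcal H(K_{\alpha,a,d})$ and every $\delta\in(0,\alpha/2)$, $$\|\phi-A_N^*(\phi)\|_{L^2([-a,a]^d)}\le C_{\alpha,\delta',d}\,\|\phi\|_{K_{\alpha,a,d}}\,(2a)^{\alpha d}\,N^{-\alpha/2+\delta},\qquad \delta'=\min\left\{\delta,\tfrac\alpha2-\tfrac14\right\}.$$ In particular, for $\delta\le\frac\alpha2-\frac14$ the constant is $C_{\alpha,\delta,d}$ itself. -/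

import Mathlib

open MeasureTheory

noncomputable section

namespace Korobov

/-- The box `[-a,a]^d`. -/
def box (a : ℝ) (d : ℕ) : Set (Fin d → ℝ) := Set.Icc (fun _ => -a) (fun _ => a)

/-- The linear scaling `y ↦ 2a y - (a,…,a)`, which maps `[0,1]^d` onto `[-a,a]^d`. -/
def scaling (a : ℝ) {d : ℕ} (y : Fin d → ℝ) : Fin d → ℝ := fun j => 2 * a * y j - a

/-- The inverse of `scaling a` (for `a ≠ 0`). -/
def scalingInv (a : ℝ) {d : ℕ} (x : Fin d → ℝ) : Fin d → ℝ := fun j => (x j + a) / (2 * a)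

/-! ### The Korobov space on the box -/

/-- The scaled trigonometric functions, orthonormal in `L²([-a,a]^d)`. -/
def boxBasis (a : ℝ) {d : ℕ} (h : Fin d → ℤ) (x : Fin d → ℝ) : ℂ :=
  ∏ j, ((1 / Real.sqrt (2 * a) : ℝ) : ℂ) *
    Complex.exp (2 * Real.pi * Complex.I * (h j : ℂ) * (((x j + a) / (2 * a) : ℝ) : ℂ))

/-- The Fourier coefficients with respect to `boxBasis`. -/
def boxCoeff (a : ℝ) {d : ℕ} (φ : (Fin d → ℝ) → ℂ) (h : Fin d → ℤ) : ℂ :=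
  ∫ x in box a d, φ x * (starRingEnd ℂ) (boxBasis a h x)

/-- `∏ⱼ r(hⱼ)` with `r(0) = √(2a)` and `r(k) = |π k / a|^α` for `k ≠ 0`. -/
def boxWeight (α : ℕ) (a : ℝ) {d : ℕ} (h : Fin d → ℤ) : ℝ :=
  ∏ j, if h j = 0 then Real.sqrt (2 * a) else |Real.pi * (h j : ℝ) / a| ^ α

/-- Membership in the Korobov space of smoothness `α` on `[-a,a]^d`: on the whole (closed) box the
function is the sum of its (absolutely convergent) Fourier series, and its Korobov norm is finite.
Values outside the box play no role. -/
def MemKorobovBox (α : ℕ) (a : ℝ) {d : ℕ} (φ : (Fin d → ℝ) → ℂ) : Prop :=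
  (∀ x ∈ box a d, HasSum (fun h : Fin d → ℤ => boxCoeff a φ h * boxBasis a h x) (φ x)) ∧
    Summable (fun h : Fin d → ℤ => ‖boxCoeff a φ h‖ ^ 2 * boxWeight α a h ^ 2)

/-- The norm of the Korobov space on `[-a,a]^d`. -/
def korobovBoxNorm (α : ℕ) (a : ℝ) {d : ℕ} (φ : (Fin d → ℝ) → ℂ) : ℝ :=
  Real.sqrt (∑' h : Fin d → ℤ, ‖boxCoeff a φ h‖ ^ 2 * boxWeight α a h ^ 2)

/-! ### The lattice algorithm on the unit cube -/

/-- `∏ⱼ r(hⱼ)` with `r(0) = 1` and `r(k) = |2 π k|^α` for `k ≠ 0`: the square roots of the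
weights of the Fourier coefficients in the squared norm of the Korobov space on `[0,1]^d`. -/
def cubeWeight (α : ℕ) {d : ℕ} (h : Fin d → ℤ) : ℝ :=
  ∏ j, if h j = 0 then (1 : ℝ) else |2 * Real.pi * (h j : ℝ)| ^ α

/-- `ℓ · z ≡ 0 (mod N)`, that is, `ℓ` lies in the dual lattice of the generating vector `z`. -/
def InDual (N : ℕ) {d : ℕ} (z : Fin d → ℕ) (l : Fin d → ℤ) : Prop :=
  (N : ℤ) ∣ ∑ j, l j * (z j : ℤ)

/-- The quality criterion `S(z)` of a rank-1 lattice rule for `L²` approximation: the sum over all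
`h ∈ ℤ^d` and all nonzero `ℓ` in the dual lattice of `1 / (r(h)² r(h+ℓ)²)`. -/
def latticeCriterion (α N : ℕ) {d : ℕ} (z : Fin d → ℕ) : ℝ :=
  ∑' h : Fin d → ℤ, ∑' l : {l : Fin d → ℤ // l ≠ 0 ∧ InDual N z l},
    1 / (cubeWeight α h ^ 2 * cubeWeight α (h + l.1) ^ 2)

/-- The part `T_s(z)` of the criterion that collects the dual vectors whose last nonzero component
is the one with index `s`. It depends only on the components of `z` up to index `s`, and the sum
over `s` of these parts is `S(z)`. -/
def cbcCriterion (α N : ℕ) {d : ℕ} (s : Fin d) (z : Fin d → ℕ) : ℝ :=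
  ∑' h : Fin d → ℤ,
    ∑' l : {l : Fin d → ℤ // l s ≠ 0 ∧ (∀ j, s < j → l j = 0) ∧ InDual N z l},
      1 / (cubeWeight α h ^ 2 * cubeWeight α (h + l.1) ^ 2)

/-- `z` is an output of the component-by-component (CBC) construction: its components lie in
`{1,…,N-1}`, and each component in turn minimizes `T_s` over `{1,…,N-1}`, the earlier components
being fixed. (The later components do not enter into `T_s`.) -/
def IsCBC (α N : ℕ) {d : ℕ} (z : Fin d → ℕ) : Prop :=
  ∀ s : Fin d, z s ∈ Set.Icc 1 (N - 1) ∧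
    ∀ c ∈ Set.Icc 1 (N - 1), cbcCriterion α N s z ≤ cbcCriterion α N s (Function.update z s c)

/-- The lattice point `{k z / N}` (componentwise fractional part) in `[0,1)^d`. -/
def latticePoint (N : ℕ) {d : ℕ} (z : Fin d → ℕ) (k : ℕ) : Fin d → ℝ :=
  fun j => Int.fract ((k : ℝ) * (z j : ℝ) / (N : ℝ))

/-- `exp(2 π i ⟨h, y⟩)`. -/
def cubeBasis {d : ℕ} (h : Fin d → ℤ) (y : Fin d → ℝ) : ℂ :=
  Complex.exp (2 * Real.pi * Complex.I * ((∑ j, (h j : ℝ) * y j : ℝ) : ℂ))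

/-- The lattice rule approximation of the Fourier coefficient of `f` at `h`. -/
def latticeCoeff (N : ℕ) {d : ℕ} (z : Fin d → ℕ) (f : (Fin d → ℝ) → ℂ) (h : Fin d → ℤ) : ℂ :=
  (1 / (N : ℂ)) * ∑ k ∈ Finset.Icc 1 N,
    f (latticePoint N z k) * (starRingEnd ℂ) (cubeBasis h (latticePoint N z k))

/-- The index set `{h : r(h)² ≤ M}`. -/
def truncationSet (α : ℕ) (M : ℝ) (d : ℕ) : Set (Fin d → ℤ) := {h | cubeWeight α h ^ 2 ≤ M}

/-- The index set is finite, so that the sum in `latticeAlgorithm` is a finite sum. -/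
theorem truncationSet_finite (α : ℕ) (hα : 1 ≤ α) (M : ℝ) (d : ℕ) :
    (truncationSet α M d).Finite := by
  have hle : ∀ (k : ℤ), k ≠ 0 → |(k : ℝ)| ≤ |2 * Real.pi * (k : ℝ)| ^ α := by
    intro k hk
    have h1 : (1 : ℝ) ≤ |(k : ℝ)| := by
      have := Int.one_le_abs hk
      exact_mod_cast this
    have h2 : |(k : ℝ)| ≤ |2 * Real.pi * (k : ℝ)| := by
      rw [abs_mul, abs_of_pos (by positivity : (0 : ℝ) < 2 * Real.pi)]
      nlinarith [Real.pi_gt_three]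
    exact h2.trans (le_self_pow₀ (h1.trans h2) (by omega))
  have hone : ∀ (k : ℤ), (1 : ℝ) ≤ if k = 0 then (1 : ℝ) else |2 * Real.pi * (k : ℝ)| ^ α := by
    intro k
    split_ifs with hk
    · exact le_rfl
    · refine le_trans ?_ (hle k hk)
      have := Int.one_le_abs hk
      exact_mod_cast this
  refine (Set.finite_Icc (fun _ : Fin d => -⌈M⌉) (fun _ => ⌈M⌉)).subset ?_
  intro h hh
  have key : ∀ j, |h j| ≤ ⌈M⌉ := by
    intro j
    have hw : (if h j = 0 then (1 : ℝ) else |2 * Real.pi * (h j : ℝ)| ^ α) ≤ cubeWeight α h := by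
      unfold cubeWeight
      rw [← Finset.mul_prod_erase _ _ (Finset.mem_univ j)]
      refine le_mul_of_one_le_right (zero_le_one.trans (hone _)) ?_
      exact Finset.one_le_prod fun i _ => hone (h i)
    have hw1 : (1 : ℝ) ≤ cubeWeight α h := (hone (h j)).trans hw
    have hM : cubeWeight α h ≤ M := (le_self_pow₀ hw1 two_ne_zero).trans hh
    have habs : |(h j : ℝ)| ≤ M := by
      by_cases hj : h j = 0
      · rw [hj]; simp; linarith
      · rw [if_neg hj] at hw
        exact (hle _ hj).trans (hw.trans hM)
    have : ((|h j| : ℤ) : ℝ) ≤ (⌈M⌉ : ℝ) := by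
      push_cast
      exact habs.trans (Int.le_ceil M)
    exact_mod_cast this
  exact ⟨fun j => (abs_le.mp (key j)).1, fun j => (abs_le.mp (key j)).2⟩

/-- The lattice algorithm on `[0,1]^d`, with generating vector `z` and with truncation parameter
`M = 1/√S(z)`, the minimizer of the error bound `1/M + M S(z)`. -/
def latticeAlgorithm (α N : ℕ) {d : ℕ} (z : Fin d → ℕ) (f : (Fin d → ℝ) → ℂ)
    (y : Fin d → ℝ) : ℂ :=
  ∑ᶠ h ∈ truncationSet α (1 / Real.sqrt (latticeCriterion α N z)) d,
    latticeCoeff N z f h * cubeBasis h y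

/-- The scaled lattice algorithm on `[-a,a]^d`. -/
def scaledLatticeAlgorithm (α : ℕ) (a : ℝ) (N : ℕ) {d : ℕ} (z : Fin d → ℕ)
    (φ : (Fin d → ℝ) → ℂ) : (Fin d → ℝ) → ℂ :=
  latticeAlgorithm α N z (φ ∘ scaling a) ∘ scalingInv a

/-! ### The constant -/

/-- `ζ(s) = ∑_{n ≥ 1} n^{-s}` for real `s > 1`. -/
def realZeta (s : ℝ) : ℝ := ∑' n : ℕ, 1 / ((n : ℝ) + 1) ^ s

/-- The factor `κ_{α,δ}`. -/
def kappa (α : ℕ) (δ : ℝ) : ℝ :=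
  Real.sqrt 2 *
    (max 6 (5 / 2 + (2 : ℝ) ^ (2 * (α : ℝ) / ((α : ℝ) - 2 * δ) + 1))) ^ ((α : ℝ) / 2 - δ)

/-- The constant `C_{α,δ,d}`. -/
def errorConst (α : ℕ) (δ : ℝ) (d : ℕ) : ℝ :=
  kappa α δ *
    (∑ u : Finset (Fin d), ((max u.card 1 : ℕ) : ℝ) *
      (2 * (1 / (2 * Real.pi)) ^ ((α : ℝ) / ((α : ℝ) - 2 * δ)) *
        realZeta ((α : ℝ) / ((α : ℝ) - 2 * δ))) ^ u.card) ^ ((α : ℝ) - 2 * δ)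

end Korobov

end

namespace Korobov

open scoped ENNReal

/-! ### Sums of extended nonnegative reals -/

/-! The error splits in Fourier space. Outside the truncation set the error coefficient is the
coefficient of `φ` itself; inside, it is minus the aliasing sum over the nonzero dual vectors,
because averaging a character over the lattice points tests membership in the dual lattice. Parseval
turns the squared `L²` error into the sum of the squares of these coefficients. Since `r(h)² > M`
outside and `r(h)² ≤ M` inside, Cauchy–Schwarz on the aliasing sum bounds it by `(1/M + M S) E`,
where `E` is the squared norm with the cube weights (`tsum_errorCoeff_le`). For `M = S^(-1/2)` the
factor is `2√S`, and comparing weights costs `(2a)^(αd)` in the norm.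

It remains to bound `S` (`IsCBC.latticeCriterion_rpow_le`). For `p ≤ 1` the map `t ↦ t^p` is
subadditive, so `S^p ≤ ∑ T_s^p`, and each `T_s^p` is at most the same sum with weight exponent `β =
2αp`. The chosen component does no worse than the average over all `N - 1` candidates
(`sum_dualSum_update_le`). If `N ∤ ℓ_s`, primality leaves at most one candidate with `ℓ` in its dual
lattice; if `N ∣ ℓ_s`, all may qualify, but then `h_s` or `h_s + ℓ_s` is large and the weight gains
a factor of order `N^(-β)`. Hence `S^p = O(1/N)`, and `p = 1/(4(α/2 - δ))` gives the rate. The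
condition `p ≤ 1` reads `δ ≤ α/2 - 1/4`, whence `δ'`. -/

theorem tsum_pi_prod {κ : Type*} {d : ℕ} (f : Fin d → κ → ℝ≥0∞) :
    ∑' h : Fin d → κ, ∏ j, f j (h j) = ∏ j, ∑' k, f j k := by
  induction d with
  | zero => simp
  | succ d ih =>
    rw [← (Fin.consEquiv fun _ : Fin (d + 1) => κ).tsum_eq, ENNReal.tsum_prod', Fin.prod_univ_succ,
      ← ENNReal.tsum_mul_right]
    refine tsum_congr fun k => ?_
    rw [← ih, ← ENNReal.tsum_mul_left]
    refine tsum_congr fun h => ?_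
    simp [Fin.prod_univ_succ, Fin.consEquiv]

theorem sum_rpow_le {ι : Type*} (s : Finset ι) (f : ι → ℝ≥0∞) {p : ℝ} (hp : 0 < p)
    (hp1 : p ≤ 1) : (∑ i ∈ s, f i) ^ p ≤ ∑ i ∈ s, f i ^ p := by
  classical
  induction s using Finset.induction_on with
  | empty => simp [hp]
  | insert i s hi ih =>
    rw [Finset.sum_insert hi, Finset.sum_insert hi]
    exact (ENNReal.rpow_add_le_add_rpow _ _ hp.le hp1).trans (add_le_add le_rfl ih)

/-- Trades the weight exponent `2α` for the smaller `2αp`; only finite subadditivity of `t ↦ t^p`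
and a supremum over partial sums are involved. -/
theorem tsum_rpow_le {ι : Type*} (f : ι → ℝ≥0∞) {p : ℝ} (hp : 0 < p) (hp1 : p ≤ 1) :
    (∑' i, f i) ^ p ≤ ∑' i, f i ^ p := by
  rw [← ENNReal.le_rpow_inv_iff hp, ENNReal.tsum_eq_iSup_sum]
  refine iSup_le fun s => ?_
  rw [ENNReal.le_rpow_inv_iff hp]
  exact (sum_rpow_le s f hp hp1).trans (ENNReal.sum_le_tsum s)

theorem tsum_mul_sq_le {ι : Type*} (f g : ι → ℝ≥0∞) :
    (∑' i, f i * g i) ^ 2 ≤ (∑' i, f i ^ 2) * ∑' i, g i ^ 2 := by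
  let _ : MeasurableSpace ι := ⊤
  have := ENNReal.lintegral_mul_le_Lp_mul_Lq (Measure.count : Measure ι)
    Real.HolderConjugate.two_two (f := f) (g := g) measurable_from_top.aemeasurable
    measurable_from_top.aemeasurable
  simp only [lintegral_count, Pi.mul_apply, ENNReal.rpow_two] at this
  refine (pow_le_pow_left' this 2).trans_eq ?_
  rw [mul_pow, ← ENNReal.rpow_natCast, ← ENNReal.rpow_natCast, ← ENNReal.rpow_mul,
    ← ENNReal.rpow_mul]
  norm_num

/-! ### Weighted sums over dual lattices -/

/-- The sum of `∏ⱼ ρ(hⱼ) ρ(hⱼ+ℓⱼ)` over all `h` and over the dual vectors `ℓ` satisfying `P`. -/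
noncomputable def dualSum (N : ℕ) (ρ : ℤ → ℝ≥0∞) {d : ℕ} (P : (Fin d → ℤ) → Prop)
    (z : Fin d → ℕ) : ℝ≥0∞ :=
  open Classical in
  ∑' h : Fin d → ℤ, ∑' l : Fin d → ℤ,
    if P l ∧ InDual N z l then (∏ j, ρ (h j)) * ∏ j, ρ (h j + l j) else 0

/-- `s` is the index of the last nonzero component of `l`. -/
def IsLast {d : ℕ} (s : Fin d) (l : Fin d → ℤ) : Prop := l s ≠ 0 ∧ ∀ j, s < j → l j = 0

theorem exists_isLast {d : ℕ} {l : Fin d → ℤ} (hl : l ≠ 0) : ∃ s, IsLast s l := by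
  classical
  have hne : (Finset.univ.filter fun j => l j ≠ 0).Nonempty := by
    obtain ⟨j, hj⟩ := Function.ne_iff.mp hl
    exact ⟨j, by simpa using hj⟩
  refine ⟨_, (Finset.mem_filter.mp (Finset.max'_mem _ hne)).2, fun j hj => ?_⟩
  by_contra h
  exact absurd (Finset.le_max' _ j (by simpa using h)) (not_le.mpr hj)

/-- Each nonzero `l` is charged to its last nonzero index. The two sides are in fact equal, but this
direction suffices. -/
theorem dualSum_ne_zero_le (N : ℕ) (ρ : ℤ → ℝ≥0∞) {d : ℕ} (z : Fin d → ℕ) :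
    dualSum N ρ (fun l => l ≠ 0) z ≤ ∑ s, dualSum N ρ (IsLast s) z := by
  classical
  unfold dualSum
  rw [← tsum_fintype (L := .unconditional _), ENNReal.tsum_comm (α := Fin d)]
  refine ENNReal.tsum_le_tsum fun h => ?_
  rw [ENNReal.tsum_comm]
  refine ENNReal.tsum_le_tsum fun l => ?_
  split_ifs with hl
  · obtain ⟨s, hs⟩ := exists_isLast hl.1
    refine le_trans ?_ (ENNReal.le_tsum s)
    simp [hs, hl.2]
  · exact zero_le

theorem dualSum_rpow_le (N : ℕ) (ρ : ℤ → ℝ≥0∞) {d : ℕ} (P : (Fin d → ℤ) → Prop)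
    (z : Fin d → ℕ) {p : ℝ} (hp : 0 < p) (hp1 : p ≤ 1) :
    dualSum N ρ P z ^ p ≤ dualSum N (fun k => ρ k ^ p) P z := by
  unfold dualSum
  refine (tsum_rpow_le _ hp hp1).trans (ENNReal.tsum_le_tsum fun h => ?_)
  refine (tsum_rpow_le _ hp hp1).trans (ENNReal.tsum_le_tsum fun l => ?_)
  split_ifs
  · rw [ENNReal.mul_rpow_of_nonneg _ _ hp.le, ENNReal.prod_rpow_of_nonneg hp.le,
      ENNReal.prod_rpow_of_nonneg hp.le]
  · simp [hp]

/-- Only coordinate `s` is coupled, so the sum factors over coordinates and each of the other `d -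
1` contributes `(∑ ρ)²`. -/
theorem tsum_pair_prod (ρ : ℤ → ℝ≥0∞) {d : ℕ} (s : Fin d) (u : ℤ → ℤ → ℝ≥0∞) :
    ∑' h : Fin d → ℤ, ∑' g : Fin d → ℤ, ((∏ j, ρ (h j)) * ∏ j, ρ (g j)) * u (h s) (g s) =
      (∑' k, ρ k) ^ (2 * (d - 1)) * ∑' a, ∑' b, ρ a * ρ b * u a b := by
  classical
  let q : Fin d → ℤ × ℤ → ℝ≥0∞ := fun j x =>
    ρ x.1 * ρ x.2 * if j = s then u x.1 x.2 else 1
  have h1 : ∀ h g : Fin d → ℤ, ((∏ j, ρ (h j)) * ∏ j, ρ (g j)) * u (h s) (g s) =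
      ∏ j, q j (h j, g j) := by
    intro h g
    simp only [q, Finset.prod_mul_distrib]
    simp
  simp_rw [h1]
  rw [← ENNReal.tsum_prod' (f := fun x : (Fin d → ℤ) × (Fin d → ℤ) => ∏ j, q j (x.1 j, x.2 j)),
    ← (Equiv.arrowProdEquivProdArrow (Fin d) (fun _ => ℤ) (fun _ => ℤ)).tsum_eq]
  simp only [Equiv.arrowProdEquivProdArrow, Equiv.coe_fn_mk, Prod.mk.eta]
  rw [tsum_pi_prod, ← Finset.mul_prod_erase _ _ (Finset.mem_univ s), mul_comm]
  congr 1
  · rw [Finset.prod_congr rfl (g := fun _ => (∑' k, ρ k) ^ 2), Finset.prod_const,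
      Finset.card_erase_of_mem (Finset.mem_univ s), Finset.card_univ, Fintype.card_fin, pow_mul]
    intro j hj
    simp only [q, if_neg (Finset.ne_of_mem_erase hj), mul_one]
    rw [ENNReal.tsum_prod', sq, ← ENNReal.tsum_mul_right]
    simp_rw [ENNReal.tsum_mul_left]
  · rw [ENNReal.tsum_prod']
    simp [q]

theorem tsum_ne_zero_eq (ρ : ℤ → ℝ≥0∞) (h0 : ρ 0 = 1) :
    ∑' k, ρ k = 1 + ∑' k, if k = 0 then 0 else ρ k := by
  rw [ENNReal.tsum_eq_add_tsum_ite 0, h0]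
  congr! 4

theorem tsum_pair_ne_le (ρ : ℤ → ℝ≥0∞) :
    ∑' a, ∑' b, ρ a * ρ b * (if b - a ≠ 0 then 1 else 0) ≤
      2 * ((∑' k, ρ k) * ∑' k, if k = 0 then 0 else ρ k) := by
  -- If `a ≠ b`, at least one of them is nonzero.
  have h : ∀ a b : ℤ, ρ a * ρ b * (if b - a ≠ 0 then 1 else 0) ≤
      ρ a * (if b = 0 then 0 else ρ b) + (if a = 0 then 0 else ρ a) * ρ b := by
    intro a b
    by_cases hb : b = 0
    · by_cases ha : a = 0
      · simp [ha, hb]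
      · simp [ha, hb]
    · simp only [hb, if_false]
      refine le_trans ?_ le_self_add
      split_ifs <;> simp
  refine (ENNReal.tsum_le_tsum fun a => ENNReal.tsum_le_tsum fun b => h a b).trans_eq ?_
  simp_rw [ENNReal.tsum_add, ENNReal.tsum_mul_left, ENNReal.tsum_mul_right]
  ring

/-- Write `b = a + N m`. Since `N|m| ≤ |a| + |b|`, one of `|a|`, `|b|` is at least `N|m|/2`; its
weight is replaced by `τ ρ(m)`, and the other index then runs freely. -/
theorem tsum_pair_dvd_le (ρ : ℤ → ℝ≥0∞) {N : ℕ} (hN : 0 < N) {τ : ℝ≥0∞}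
    (hτ : ∀ k m : ℤ, m ≠ 0 → N * |m| ≤ 2 * |k| → ρ k ≤ τ * ρ m) :
    ∑' a, ∑' b, ρ a * ρ b * (if b - a ≠ 0 ∧ (N : ℤ) ∣ b - a then 1 else 0) ≤
      2 * τ * ((∑' k, ρ k) * ∑' k, if k = 0 then 0 else ρ k) := by
  have hN' : (N : ℤ) ≠ 0 := by exact_mod_cast hN.ne'
  have h1 : ∀ a : ℤ, ∑' b, ρ a * ρ b * (if b - a ≠ 0 ∧ (N : ℤ) ∣ b - a then 1 else 0) ≤
      ∑' m : ℤ, if m = 0 then 0 else ρ a * ρ (a + N * m) := by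
    intro a
    rw [← (Equiv.addLeft a).tsum_eq]
    have hinj : Function.Injective fun m : ℤ => (N : ℤ) * m := mul_right_injective₀ hN'
    rw [← hinj.tsum_eq]
    · refine ENNReal.tsum_le_tsum fun m => ?_
      by_cases hm : m = 0 <;> simp [hm, hN.ne']
    · intro b hb
      simp only [Equiv.coe_addLeft, add_sub_cancel_left, Function.mem_support] at hb
      have : (N : ℤ) ∣ b := by
        by_contra hcon
        simp [hcon] at hb
      obtain ⟨m, rfl⟩ := this
      exact ⟨m, rfl⟩
  have h2 : ∀ a m : ℤ, (if m = 0 then 0 else ρ a * ρ (a + N * m)) ≤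
      τ * (ρ (a + N * m) * (if m = 0 then 0 else ρ m)) +
        τ * (ρ a * (if m = 0 then 0 else ρ m)) := by
    intro a m
    by_cases hm : m = 0
    · simp [hm]
    simp only [hm, if_false]
    have : (N : ℤ) * |m| ≤ |a| + |a + N * m| := by
      have h := abs_sub (a + N * m) a
      rw [add_sub_cancel_left, abs_mul, Nat.abs_cast] at h
      linarith
    rcases le_total (N * |m|) (2 * |a|) with h | h
    · refine le_trans ?_ le_self_add
      calc ρ a * ρ (a + N * m) ≤ (τ * ρ m) * ρ (a + N * m) := by gcongr; exact hτ _ _ hm h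
        _ = _ := by ring
    · refine le_trans ?_ le_add_self
      calc ρ a * ρ (a + N * m) ≤ ρ a * (τ * ρ m) := by
            gcongr; exact hτ _ _ hm (by linarith)
        _ = _ := by ring
  refine (ENNReal.tsum_le_tsum fun a => (h1 a).trans (ENNReal.tsum_le_tsum fun m => h2 a m)).trans
    (le_of_eq ?_)
  simp_rw [ENNReal.tsum_add]
  rw [ENNReal.tsum_comm]
  have h3 : ∀ m : ℤ, ∑' a, ρ (a + N * m) = ∑' a, ρ a :=
    fun m => (Equiv.addRight ((N : ℤ) * m)).tsum_eq ρ
  simp_rw [ENNReal.tsum_mul_left, ENNReal.tsum_mul_right, h3, ENNReal.tsum_mul_left]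
  ring

/-- The dual condition is a linear congruence in `c` whose leading coefficient `l s` is invertible
modulo the prime `N`. -/
theorem card_dual_le {N : ℕ} (hN : N.Prime) {d : ℕ} (s : Fin d) (z : Fin d → ℕ) (l : Fin d → ℤ)
    (hl : ¬ (N : ℤ) ∣ l s) [DecidablePred fun c => InDual N (Function.update z s c) l] :
    ((Finset.Icc 1 (N - 1)).filter fun c => InDual N (Function.update z s c) l).card ≤ 1 := by
  refine Finset.card_le_one.mpr fun a ha b hb => ?_
  rw [Finset.mem_filter, Finset.mem_Icc] at ha hb
  unfold InDual at ha hb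
  have hsum : ∀ c : ℕ, ∑ j, l j * ((Function.update z s c j : ℕ) : ℤ) =
      l s * c + ∑ j ∈ Finset.univ.erase s, l j * (z j : ℤ) := by
    intro c
    rw [← Finset.add_sum_erase _ _ (Finset.mem_univ s), Function.update_self]
    congr 1
    refine Finset.sum_congr rfl fun j hj => ?_
    rw [Function.update_of_ne (Finset.ne_of_mem_erase hj)]
  have h := dvd_sub ha.2 hb.2
  rw [hsum, hsum, add_sub_add_right_eq_sub, ← mul_sub] at h
  have h' : (N : ℤ) ∣ (a : ℤ) - b :=
    ((Nat.prime_iff_prime_int.mp hN).dvd_or_dvd h).resolve_left hl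
  have hlt : |(a : ℤ) - b| < N := by
    have := hN.two_le
    rw [abs_lt]; omega
  have := Int.eq_zero_of_abs_lt_dvd h' hlt
  omega

theorem sum_dualSum_update_le {N : ℕ} (hN : N.Prime) (ρ : ℤ → ℝ≥0∞) {d : ℕ} (s : Fin d)
    (z : Fin d → ℕ) {τ : ℝ≥0∞} (hτ : ∀ k m : ℤ, m ≠ 0 → N * |m| ≤ 2 * |k| → ρ k ≤ τ * ρ m) :
    ∑ c ∈ Finset.Icc 1 (N - 1), dualSum N ρ (IsLast s) (Function.update z s c) ≤
      (∑' k, ρ k) ^ (2 * (d - 1)) * ((2 + (N - 1 : ℕ) * (2 * τ)) *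
        ((∑' k, ρ k) * ∑' k, if k = 0 then 0 else ρ k)) := by
  classical
  -- With `a = h s` and `b = h s + l s`, this bounds the count: one candidate in general, and all `N
  -- - 1` when `N ∣ l s`.
  let u : ℤ → ℤ → ℝ≥0∞ := fun a b => (if b - a ≠ 0 then 1 else 0) +
    (N - 1 : ℕ) * (if b - a ≠ 0 ∧ (N : ℤ) ∣ b - a then 1 else 0)
  have h1 : ∑ c ∈ Finset.Icc 1 (N - 1), dualSum N ρ (IsLast s) (Function.update z s c) ≤
      ∑' h : Fin d → ℤ, ∑' g : Fin d → ℤ,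
        ((∏ j, ρ (h j)) * ∏ j, ρ (g j)) * u (h s) (g s) := by
    unfold dualSum
    rw [← Summable.tsum_finsetSum fun _ _ => ENNReal.summable]
    refine ENNReal.tsum_le_tsum fun h => ?_
    rw [← Summable.tsum_finsetSum fun _ _ => ENNReal.summable, ← (Equiv.addLeft h).tsum_eq
      (fun g : Fin d → ℤ => ((∏ j, ρ (h j)) * ∏ j, ρ (g j)) * u (h s) (g s))]
    refine ENNReal.tsum_le_tsum fun l => ?_
    simp only [Equiv.coe_addLeft, Pi.add_apply]
    by_cases hl : IsLast s l
    · simp only [hl, true_and]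
      rw [← Finset.sum_filter, Finset.sum_const, nsmul_eq_mul, mul_comm]
      refine mul_le_mul_right ?_ _
      simp only [u, add_sub_cancel_left, hl.1, ne_eq, not_false_eq_true, if_true, true_and]
      by_cases hd : (N : ℤ) ∣ l s
      · refine le_trans ?_ le_add_self
        simp only [hd, if_true, mul_one, Nat.cast_le]
        exact (Finset.card_filter_le _ _).trans (by simp)
      · refine le_trans ?_ le_self_add
        exact_mod_cast card_dual_le hN s z l hd
    · simp [hl]
  refine h1.trans ?_
  rw [tsum_pair_prod]
  refine mul_le_mul_right ?_ _
  simp only [u, mul_add, ENNReal.tsum_add, add_mul]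
  refine add_le_add (tsum_pair_ne_le ρ) ?_
  have h2 := mul_le_mul_right (tsum_pair_dvd_le ρ hN.pos hτ) ((N - 1 : ℕ) : ℝ≥0∞)
  rw [mul_assoc]
  refine le_trans (le_of_eq ?_) h2
  rw [← ENNReal.tsum_mul_left]
  refine tsum_congr fun a => ?_
  rw [← ENNReal.tsum_mul_left]
  refine tsum_congr fun b => ?_
  ring

/-! ### Power weights -/

/-- The weights `|2πk|^{-β}`, with value `1` at `k = 0`. -/
noncomputable def powWeight (β : ℝ) (k : ℤ) : ℝ≥0∞ :=
  ENNReal.ofReal (if k = 0 then 1 else |2 * Real.pi * (k : ℝ)| ^ (-β))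

/-- The sum of `|2πk|^{-β}` over nonzero integers `k`. -/
noncomputable def zetaMass (β : ℝ) : ℝ := 2 * (1 / (2 * Real.pi)) ^ β * realZeta β

theorem two_pi_mul_abs_pos {k : ℤ} (hk : k ≠ 0) : 0 < |2 * Real.pi * (k : ℝ)| := by
  have : (k : ℝ) ≠ 0 := by exact_mod_cast hk
  have := Real.pi_pos
  positivity

theorem powWeight_zero (β : ℝ) : powWeight β 0 = 1 := by simp [powWeight]

theorem powWeight_of_ne (β : ℝ) {k : ℤ} (hk : k ≠ 0) :
    powWeight β k = ENNReal.ofReal (|2 * Real.pi * (k : ℝ)| ^ (-β)) := by simp [powWeight, hk]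

theorem powWeight_rpow (β : ℝ) {p : ℝ} (hp : 0 ≤ p) (k : ℤ) :
    powWeight β k ^ p = powWeight (β * p) k := by
  by_cases hk : k = 0
  · simp [hk, powWeight_zero]
  · rw [powWeight_of_ne _ hk, powWeight_of_ne _ hk,
      ENNReal.ofReal_rpow_of_nonneg (by positivity) hp, ← Real.rpow_mul (abs_nonneg _), neg_mul]

theorem realZeta_nonneg (β : ℝ) : 0 ≤ realZeta β := tsum_nonneg fun _ => by positivity

theorem zetaMass_nonneg (β : ℝ) : 0 ≤ zetaMass β := by
  have := realZeta_nonneg β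
  have := Real.pi_pos
  unfold zetaMass
  positivity

theorem hasSum_abs_rpow {β : ℝ} (hβ : 1 < β) :
    HasSum (fun k : ℤ => if k = 0 then (0 : ℝ) else |2 * Real.pi * (k : ℝ)| ^ (-β))
      (zetaMass β) := by
  have hs : Summable fun n : ℕ => 1 / ((n : ℝ) + 1) ^ β := by
    have := (summable_nat_add_iff 1).mpr (Real.summable_one_div_nat_rpow.mpr hβ)
    simpa using this
  have hpi := Real.pi_pos
  have h1 : HasSum (fun n : ℕ => |2 * Real.pi * ((n : ℝ) + 1)| ^ (-β))
      ((1 / (2 * Real.pi)) ^ β * realZeta β) := by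
    refine (hs.hasSum.mul_left ((1 / (2 * Real.pi)) ^ β)).congr_fun fun n => ?_
    rw [abs_of_pos (by positivity), Real.mul_rpow (by positivity) (by positivity),
      Real.rpow_neg (by positivity), Real.rpow_neg (by positivity),
      Real.div_rpow zero_le_one (by positivity), Real.one_rpow, one_div, one_div]
  have h2 := HasSum.of_add_one_of_neg_add_one
    (f := fun k : ℤ => if k = 0 then (0 : ℝ) else |2 * Real.pi * (k : ℝ)| ^ (-β))
    (m := (1 / (2 * Real.pi)) ^ β * realZeta β) (m' := (1 / (2 * Real.pi)) ^ β * realZeta β)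
    (by
      refine h1.congr_fun fun n => ?_
      rw [if_neg (by omega)]
      push_cast
      rfl)
    (by
      refine h1.congr_fun fun n => ?_
      rw [if_neg (by omega)]
      push_cast
      rw [mul_neg, abs_neg])
  convert h2 using 1
  simp only [if_true, zetaMass]
  ring

theorem tsum_powWeight_ne {β : ℝ} (hβ : 1 < β) :
    ∑' k : ℤ, (if k = 0 then 0 else powWeight β k) = ENNReal.ofReal (zetaMass β) := by
  have h := hasSum_abs_rpow hβ
  rw [← h.tsum_eq, ENNReal.ofReal_tsum_of_nonneg (fun k => by split_ifs <;> positivity) h.summable]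
  refine tsum_congr fun k => ?_
  by_cases hk : k = 0
  · simp [hk]
  · simp [hk, powWeight_of_ne]

theorem tsum_powWeight {β : ℝ} (hβ : 1 < β) :
    ∑' k : ℤ, powWeight β k = ENNReal.ofReal (1 + zetaMass β) := by
  rw [tsum_ne_zero_eq _ (powWeight_zero β), tsum_powWeight_ne hβ,
    ENNReal.ofReal_add zero_le_one (zetaMass_nonneg β), ENNReal.ofReal_one]

/-- Supplies `τ = (2/N)^β` for the averaging bound. -/
theorem powWeight_le_mul {β : ℝ} (hβ : 0 ≤ β) {N : ℕ} (hN : 0 < N) (k m : ℤ) (hm : m ≠ 0)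
    (h : N * |m| ≤ 2 * |k|) :
    powWeight β k ≤ ENNReal.ofReal (2 ^ β / (N : ℝ) ^ β) * powWeight β m := by
  have hNr : (0 : ℝ) < N := by exact_mod_cast hN
  have hk : k ≠ 0 := by
    rintro rfl
    have : 0 < (N : ℤ) * |m| := mul_pos (by exact_mod_cast hN) (abs_pos.mpr hm)
    simp at h
    omega
  have h' : (N : ℝ) * |(m : ℝ)| ≤ 2 * |(k : ℝ)| := by exact_mod_cast h
  have hm' := two_pi_mul_abs_pos hm
  rw [powWeight_of_ne _ hk, powWeight_of_ne _ hm, ← ENNReal.ofReal_mul (by positivity)]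
  refine ENNReal.ofReal_le_ofReal ?_
  have h2 : (2 : ℝ) ^ β / (N : ℝ) ^ β * |2 * Real.pi * (m : ℝ)| ^ (-β) =
      (N / 2 * |2 * Real.pi * (m : ℝ)|) ^ (-β) := by
    rw [Real.mul_rpow (by positivity) (by positivity), Real.rpow_neg (by positivity : (0 : ℝ) ≤ N / 2),
      Real.div_rpow (by positivity) (by positivity), inv_div]
  rw [h2]
  refine Real.rpow_le_rpow_of_nonpos (by positivity) ?_ (by linarith)
  rw [abs_mul _ (m : ℝ), abs_mul _ (k : ℝ), abs_of_pos (by positivity : 0 < 2 * Real.pi)]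
  nlinarith [Real.pi_pos]

/-! ### The criteria as sums of extended nonnegative reals -/

theorem cubeWeight_factor_pos (α : ℕ) (k : ℤ) :
    0 < if k = 0 then (1 : ℝ) else |2 * Real.pi * (k : ℝ)| ^ α := by
  split_ifs with h
  · exact one_pos
  · exact pow_pos (two_pi_mul_abs_pos h) _

theorem cubeWeight_pos (α : ℕ) {d : ℕ} (h : Fin d → ℤ) : 0 < cubeWeight α h :=
  Finset.prod_pos fun j _ => cubeWeight_factor_pos α (h j)

theorem ofReal_one_div_cubeWeight_sq (α : ℕ) {d : ℕ} (h : Fin d → ℤ) :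
    ENNReal.ofReal (1 / cubeWeight α h ^ 2) = ∏ j, powWeight (2 * α) (h j) := by
  unfold cubeWeight powWeight
  rw [← ENNReal.ofReal_prod_of_nonneg fun j _ => by split_ifs <;> positivity,
    ← Finset.prod_pow, one_div, ← Finset.prod_inv_distrib]
  congr 1
  refine Finset.prod_congr rfl fun j _ => ?_
  by_cases hj : h j = 0
  · simp [hj]
  · rw [if_neg hj, if_neg hj, Real.rpow_neg (abs_nonneg _), ← pow_mul, mul_comm α 2,
      ← Real.rpow_natCast]
    push_cast
    rfl

/-- Crude: all constraints on `l` are dropped. It serves only to show finiteness. -/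
theorem dualSum_le (N : ℕ) (ρ : ℤ → ℝ≥0∞) {d : ℕ} (P : (Fin d → ℤ) → Prop) (z : Fin d → ℕ) :
    dualSum N ρ P z ≤ (∑' k, ρ k) ^ d * (∑' k, ρ k) ^ d := by
  have h1 : ∑' h : Fin d → ℤ, ∏ j, ρ (h j) = (∑' k, ρ k) ^ d := by
    rw [tsum_pi_prod (fun _ => ρ)]
    simp
  calc dualSum N ρ P z
      ≤ ∑' h : Fin d → ℤ, ∑' l : Fin d → ℤ, (∏ j, ρ (h j)) * ∏ j, ρ ((h + l) j) := by
        unfold dualSum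
        refine ENNReal.tsum_le_tsum fun h => ENNReal.tsum_le_tsum fun l => ?_
        split_ifs
        · exact le_rfl
        · exact zero_le
    _ = _ := by
        have h2 : ∀ h : Fin d → ℤ, ∑' l : Fin d → ℤ, (∏ j, ρ (h j)) * ∏ j, ρ ((h + l) j) =
            (∏ j, ρ (h j)) * (∑' k, ρ k) ^ d := by
          intro h
          rw [ENNReal.tsum_mul_left, ← h1]
          congr 1
          exact (Equiv.addLeft h).tsum_eq fun g => ∏ j, ρ (g j)
        simp_rw [h2]
        rw [ENNReal.tsum_mul_right, h1]

theorem dualSum_ne_top (N : ℕ) {β : ℝ} (hβ : 1 < β) {d : ℕ} (P : (Fin d → ℤ) → Prop)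
    (z : Fin d → ℕ) : dualSum N (powWeight β) P z ≠ ∞ := by
  refine ne_top_of_le_ne_top ?_ (dualSum_le N (powWeight β) P z)
  rw [tsum_powWeight hβ]
  exact ENNReal.mul_ne_top (ENNReal.pow_ne_top ENNReal.ofReal_ne_top)
    (ENNReal.pow_ne_top ENNReal.ofReal_ne_top)

theorem one_lt_two_mul_cast {α : ℕ} (hα : 1 ≤ α) : (1 : ℝ) < 2 * α := by
  have : (1 : ℝ) ≤ α := by exact_mod_cast hα
  linarith

/-- Bridge from the real-valued criteria to `ℝ≥0∞`, where rearranging needs no summability.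
Finiteness of `dualSum` ensures that no real `tsum` takes its default value `0`. -/
theorem tsum_tsum_subtype_eq_toReal {α : ℕ} (hα : 1 ≤ α) (N : ℕ) {d : ℕ}
    {P Q : (Fin d → ℤ) → Prop} {z : Fin d → ℕ} (hQ : ∀ l, Q l ↔ P l ∧ InDual N z l) :
    ∑' h : Fin d → ℤ, ∑' l : {l : Fin d → ℤ // Q l},
      1 / (cubeWeight α h ^ 2 * cubeWeight α (h + l.1) ^ 2) =
      (dualSum N (powWeight (2 * α)) P z).toReal := by
  classical
  have hfin := dualSum_ne_top N (one_lt_two_mul_cast hα) P z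
  unfold dualSum at hfin ⊢
  have h1 := ENNReal.ne_top_of_tsum_ne_top hfin
  rw [ENNReal.tsum_toReal_eq h1]
  refine tsum_congr fun h => ?_
  rw [ENNReal.tsum_toReal_eq (ENNReal.ne_top_of_tsum_ne_top (h1 h))]
  refine (tsum_subtype {l : Fin d → ℤ | Q l}
    fun l => 1 / (cubeWeight α h ^ 2 * cubeWeight α (h + l) ^ 2)).trans (tsum_congr fun l => ?_)
  by_cases hl : Q l
  · rw [Set.indicator_of_mem (show l ∈ {l | Q l} from hl), if_pos ((hQ l).mp hl),
      ← ofReal_one_div_cubeWeight_sq]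
    have := ofReal_one_div_cubeWeight_sq α (h + l)
    simp only [Pi.add_apply] at this
    rw [← this, ENNReal.toReal_mul, ENNReal.toReal_ofReal (by positivity),
      ENNReal.toReal_ofReal (by positivity), one_div_mul_one_div]
  · rw [Set.indicator_of_notMem (show l ∉ {l | Q l} from hl), if_neg (mt (hQ l).mpr hl)]
    rfl

theorem latticeCriterion_eq {α : ℕ} (hα : 1 ≤ α) (N : ℕ) {d : ℕ} (z : Fin d → ℕ) :
    latticeCriterion α N z = (dualSum N (powWeight (2 * α)) (fun l => l ≠ 0) z).toReal :=
  tsum_tsum_subtype_eq_toReal hα N fun _ => Iff.rfl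

theorem cbcCriterion_eq {α : ℕ} (hα : 1 ≤ α) (N : ℕ) {d : ℕ} (s : Fin d) (z : Fin d → ℕ) :
    cbcCriterion α N s z = (dualSum N (powWeight (2 * α)) (IsLast s) z).toReal :=
  tsum_tsum_subtype_eq_toReal hα N fun _ => and_assoc.symm

/-! ### The bound for vectors produced by the CBC construction -/

theorem IsCBC.cbcCriterion_rpow_le {α : ℕ} (hα : 1 ≤ α) {N : ℕ} (hN : N.Prime) {d : ℕ}
    {z : Fin d → ℕ} (hz : IsCBC α N z) (s : Fin d) {p : ℝ} (hp : 0 < p) (hp1 : p ≤ 1)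
    (hβ : 1 < 2 * α * p) :
    cbcCriterion α N s z ^ p ≤ (4 + 2 ^ (2 * α * p + 1)) / N *
      (zetaMass (2 * α * p) * (1 + zetaMass (2 * α * p)) ^ (2 * d - 1)) := by
  set β : ℝ := 2 * α * p with hβdef
  set m := zetaMass β
  have hm : 0 ≤ m := zetaMass_nonneg β
  have hNr : (2 : ℝ) ≤ N := by exact_mod_cast hN.two_le
  have hT := fun w : Fin d → ℕ => dualSum_ne_top N (one_lt_two_mul_cast hα) (IsLast s) w
  have hle : ∀ c ∈ Finset.Icc 1 (N - 1),
      dualSum N (powWeight (2 * α)) (IsLast s) z ^ p ≤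
        dualSum N (powWeight β) (IsLast s) (Function.update z s c) := by
    intro c hc
    have h1 := (hz s).2 c (by simpa using hc)
    rw [cbcCriterion_eq hα, cbcCriterion_eq hα, ENNReal.toReal_le_toReal (hT _) (hT _)] at h1
    refine (ENNReal.rpow_le_rpow h1 hp.le).trans ((dualSum_rpow_le N _ _ _ hp hp1).trans_eq ?_)
    simp_rw [powWeight_rpow _ hp.le, hβdef]
  have h2 := (Finset.sum_le_sum hle).trans (sum_dualSum_update_le hN (powWeight β) s z
    (powWeight_le_mul (by linarith) hN.pos))
  rw [Finset.sum_const, Nat.card_Icc, add_tsub_cancel_right, nsmul_eq_mul, tsum_powWeight hβ,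
    tsum_powWeight_ne hβ] at h2
  have h3 := ENNReal.toReal_mono (by finiteness) h2
  simp only [ENNReal.toReal_mul, ENNReal.toReal_natCast, ENNReal.toReal_pow,
    ← ENNReal.toReal_rpow] at h3
  rw [ENNReal.toReal_add (by finiteness) (by finiteness)] at h3
  simp only [ENNReal.toReal_mul, ENNReal.toReal_natCast, ENNReal.toReal_ofNat] at h3
  rw [ENNReal.toReal_ofReal (by positivity), ENNReal.toReal_ofReal (by positivity),
    ENNReal.toReal_ofReal (by positivity), ← cbcCriterion_eq hα, Nat.cast_sub hN.one_le,
    Nat.cast_one] at h3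
  have hd : 2 * d - 1 = 2 * (d - 1) + 1 := by have := s.pos; omega
  rw [hd, pow_succ]
  have hNβ : (2 : ℝ) ^ β / (N : ℝ) ^ β ≤ 2 ^ β / N := by
    gcongr
    exact Real.self_le_rpow_of_one_le (by linarith) hβ.le
  -- The factor `N - 1` is pulled out to cancel the number of candidates; `2 ≤ 4 (N - 1) / N`
  -- because `N ≥ 2`.
  have h4 : 2 + ((N : ℝ) - 1) * (2 * (2 ^ β / (N : ℝ) ^ β)) ≤
      ((N : ℝ) - 1) * ((4 + 2 ^ (β + 1)) / N) := by
    have h5 : 2 ≤ ((N : ℝ) - 1) * (4 / N) := by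
      rw [mul_div_assoc', le_div_iff₀ (by linarith)]
      linarith
    have h6 : ((N : ℝ) - 1) * (2 * (2 ^ β / (N : ℝ) ^ β)) ≤ ((N : ℝ) - 1) * (2 * (2 ^ β / N)) :=
      mul_le_mul_of_nonneg_left (by linarith) (by linarith)
    rw [Real.rpow_add_one two_ne_zero, add_div, mul_add]
    refine add_le_add h5 (h6.trans_eq ?_)
    ring
  refine le_of_mul_le_mul_left ?_ (by linarith : (0 : ℝ) < N - 1)
  refine h3.trans ((mul_le_mul_of_nonneg_left
    (mul_le_mul_of_nonneg_right h4 (by positivity)) (by positivity)).trans_eq ?_)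
  ring

theorem IsCBC.latticeCriterion_rpow_le {α : ℕ} (hα : 1 ≤ α) {N : ℕ} (hN : N.Prime) {d : ℕ}
    {z : Fin d → ℕ} (hz : IsCBC α N z) {p : ℝ} (hp : 0 < p) (hp1 : p ≤ 1)
    (hβ : 1 < 2 * α * p) :
    latticeCriterion α N z ^ p ≤ (4 + 2 ^ (2 * α * p + 1)) / N *
      (d * zetaMass (2 * α * p) * (1 + zetaMass (2 * α * p)) ^ (2 * d - 1)) := by
  have hfin := fun s => dualSum_ne_top N (one_lt_two_mul_cast hα) (IsLast s) z
  have h1 := ENNReal.rpow_le_rpow (dualSum_ne_zero_le N (powWeight (2 * α)) z) hp.le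
  have h2 := ENNReal.toReal_mono (ENNReal.sum_ne_top.mpr fun s _ =>
      ENNReal.rpow_ne_top_of_nonneg hp.le (hfin s)) (h1.trans (sum_rpow_le _ _ hp hp1))
  rw [ENNReal.toReal_sum fun s _ => ENNReal.rpow_ne_top_of_nonneg hp.le (hfin s)] at h2
  simp only [← ENNReal.toReal_rpow, ← latticeCriterion_eq hα, ← cbcCriterion_eq hα] at h2
  refine h2.trans ((Finset.sum_le_sum fun s _ =>
    hz.cbcCriterion_rpow_le hα hN s hp hp1 hβ).trans_eq ?_)
  rw [Finset.sum_const, Finset.card_univ, Fintype.card_fin, nsmul_eq_mul]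
  ring

/-- Makes the truncation parameter `1/√S` positive. The witness is `h = 0`, `l = (N,…,N)`, which is
nonzero because `d ≥ 1`. -/
theorem latticeCriterion_pos {α : ℕ} (hα : 1 ≤ α) {N : ℕ} (hN : 0 < N) {d : ℕ} (hd : 1 ≤ d)
    (z : Fin d → ℕ) : 0 < latticeCriterion α N z := by
  classical
  rw [latticeCriterion_eq hα]
  refine ENNReal.toReal_pos ?_ (dualSum_ne_top N (one_lt_two_mul_cast hα) _ z)
  unfold dualSum
  rw [Ne, ENNReal.tsum_eq_zero]
  intro h
  have h1 := ENNReal.tsum_eq_zero.mp (h 0) (fun _ => (N : ℤ))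
  have hmem : (fun _ : Fin d => (N : ℤ)) ≠ 0 ∧ InDual N z fun _ => (N : ℤ) := by
    refine ⟨Function.ne_iff.mpr ⟨⟨0, hd⟩, ?_⟩, Finset.dvd_sum fun j _ => dvd_mul_right _ _⟩
    simpa using hN.ne'
  rw [if_pos hmem, ← ofReal_one_div_cubeWeight_sq] at h1
  have h2 := ofReal_one_div_cubeWeight_sq α (0 + fun _ : Fin d => (N : ℤ))
  simp only [Pi.add_apply] at h2
  simp only [Pi.zero_apply] at h1 h2
  have hpos := fun h : Fin d → ℤ => cubeWeight_pos α h
  rw [← h2, mul_eq_zero, ENNReal.ofReal_eq_zero, ENNReal.ofReal_eq_zero, not_lt.symm,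
    not_lt.symm] at h1
  rcases h1 with h1 | h1
  · exact h1 (one_div_pos.mpr (pow_pos (hpos _) 2))
  · exact h1 (one_div_pos.mpr (pow_pos (hpos _) 2))

/-- Greedy choice over a finite set. Since `T_s` sees only the components up to `s`, later choices
do not disturb earlier minimality. -/
theorem exists_isCBC (α : ℕ) {N : ℕ} (hN : N.Prime) (d : ℕ) :
    ∃ z : Fin d → ℕ, IsCBC α N z := by
  have hcongr : ∀ (s : Fin d) (z w : Fin d → ℕ), (∀ j ≤ s, z j = w j) →
      cbcCriterion α N s z = cbcCriterion α N s w := by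
    intro s z w hzw
    have : ∀ l : Fin d → ℤ, (l s ≠ 0 ∧ (∀ j, s < j → l j = 0) ∧ InDual N z l) ↔
        (l s ≠ 0 ∧ (∀ j, s < j → l j = 0) ∧ InDual N w l) := by
      intro l
      refine and_congr_right fun _ => and_congr_right fun hl => ?_
      unfold InDual
      rw [Finset.sum_congr rfl]
      intro j _
      rcases le_or_gt j s with h | h
      · rw [hzw j h]
      · rw [hl j h, zero_mul, zero_mul]
    unfold cbcCriterion
    refine tsum_congr fun h => ?_
    exact (Equiv.subtypeEquivRight this).tsum_eq
      fun l => 1 / (cubeWeight α h ^ 2 * cubeWeight α (h + l.1) ^ 2)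
  have key : ∀ k ≤ d, ∃ z : Fin d → ℕ, ∀ s : Fin d, (s : ℕ) < k → z s ∈ Set.Icc 1 (N - 1) ∧
      ∀ c ∈ Set.Icc 1 (N - 1),
        cbcCriterion α N s z ≤ cbcCriterion α N s (Function.update z s c) := by
    intro k
    induction k with
    | zero => exact fun _ => ⟨0, fun s hs => absurd hs (Nat.not_lt_zero _)⟩
    | succ k ih =>
      intro hk
      obtain ⟨z, hz⟩ := ih (by omega)
      let t : Fin d := ⟨k, hk⟩
      obtain ⟨b, hb, hmin⟩ := Finset.exists_min_image (Finset.Icc 1 (N - 1))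
        (fun c => cbcCriterion α N t (Function.update z t c))
        ⟨1, Finset.mem_Icc.mpr ⟨le_rfl, by have := hN.two_le; omega⟩⟩
      refine ⟨Function.update z t b, fun s hs => ?_⟩
      rcases (Nat.lt_succ_iff_lt_or_eq.mp hs) with h | h
      · have hst : ∀ j ≤ s, j ≠ t := fun j hj => ne_of_lt (lt_of_le_of_lt hj h)
        refine ⟨by rw [Function.update_of_ne (hst s le_rfl)]; exact (hz s h).1, fun c hc => ?_⟩
        rw [hcongr s (Function.update z t b) z fun j hj => Function.update_of_ne (hst j hj) _ _,
          hcongr s (Function.update (Function.update z t b) s c) (Function.update z s c)]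
        · exact (hz s h).2 c hc
        · intro j hj
          by_cases hjs : j = s
          · rw [hjs, Function.update_self, Function.update_self]
          · rw [Function.update_of_ne hjs, Function.update_of_ne hjs,
              Function.update_of_ne (hst j hj)]
      · obtain rfl : s = t := Fin.ext h
        refine ⟨by rw [Function.update_self]; simpa using hb, fun c hc => ?_⟩
        rw [Function.update_idem]
        exact hmin c (by simpa using hc)
  obtain ⟨z, hz⟩ := key d le_rfl
  exact ⟨z, fun s => hz s s.isLt⟩

open scoped ComplexConjugate

/-! ### Trigonometric functions on the cube and on the box -/

theorem norm_cubeBasis {d : ℕ} (h : Fin d → ℤ) (y : Fin d → ℝ) : ‖cubeBasis h y‖ = 1 := by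
  rw [cubeBasis, Complex.norm_exp]
  simp

theorem cubeBasis_mul_conj {d : ℕ} (m h : Fin d → ℤ) (y : Fin d → ℝ) :
    cubeBasis m y * conj (cubeBasis h y) = cubeBasis (m - h) y := by
  unfold cubeBasis
  rw [← Complex.exp_conj, ← Complex.exp_add]
  congr 1
  simp only [map_mul, Complex.conj_I, Complex.conj_ofReal, map_ofNat, Pi.sub_apply, Int.cast_sub,
    sub_mul, Finset.sum_sub_distrib, Complex.ofReal_sub]
  ring

theorem boxBasis_eq_mul_cubeBasis (a : ℝ) {d : ℕ} (h : Fin d → ℤ) (x : Fin d → ℝ) :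
    boxBasis a h x = ((1 / Real.sqrt (2 * a) : ℝ) : ℂ) ^ d * cubeBasis h (scalingInv a x) := by
  unfold boxBasis cubeBasis scalingInv
  rw [Finset.prod_mul_distrib, Finset.prod_const, Finset.card_univ, Fintype.card_fin,
    ← Complex.exp_sum]
  congr 2
  push_cast
  rw [Finset.mul_sum]
  refine Finset.sum_congr rfl fun j _ => ?_
  ring

theorem norm_boxBasis (a : ℝ) {d : ℕ} (h : Fin d → ℤ) (x : Fin d → ℝ) :
    ‖boxBasis a h x‖ = (1 / Real.sqrt (2 * a)) ^ d := by
  rw [boxBasis_eq_mul_cubeBasis, norm_mul, norm_cubeBasis, mul_one, norm_pow, Complex.norm_real,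
    Real.norm_of_nonneg (by positivity)]

theorem continuous_boxBasis (a : ℝ) {d : ℕ} (h : Fin d → ℤ) :
    Continuous (boxBasis a h) := by
  unfold boxBasis
  fun_prop

theorem integral_exp_box {a : ℝ} (ha : 0 < a) (n : ℤ) :
    ∫ x in Set.Icc (-a) a,
      Complex.exp (2 * Real.pi * Complex.I * (n : ℂ) * (((x + a) / (2 * a) : ℝ) : ℂ)) =
      if n = 0 then 2 * (a : ℂ) else 0 := by
  have ha' : (a : ℂ) ≠ 0 := by exact_mod_cast ha.ne'
  rw [integral_Icc_eq_integral_Ioc, ← intervalIntegral.integral_of_le (by linarith)]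
  split_ifs with hn
  · simp [hn]
    ring
  · set c : ℂ := 2 * Real.pi * Complex.I * (n : ℂ) / (2 * a) with hc
    have hc0 : c ≠ 0 := by
      have hn' : (n : ℂ) ≠ 0 := by exact_mod_cast hn
      have hpi : (Real.pi : ℂ) ≠ 0 := by exact_mod_cast Real.pi_ne_zero
      have := Complex.I_ne_zero
      simp [hc, hn', ha', hpi]
    have h1 : ∀ x : ℝ, Complex.exp (2 * Real.pi * Complex.I * (n : ℂ) *
        (((x + a) / (2 * a) : ℝ) : ℂ)) = Complex.exp (c * a) * Complex.exp (c * x) := by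
      intro x
      rw [← Complex.exp_add, hc]
      congr 1
      push_cast
      field_simp
      ring
    simp_rw [h1]
    rw [intervalIntegral.integral_const_mul, integral_exp_mul_complex hc0]
    -- The two exponents differ by `2πi n`, so the endpoint values of the primitive cancel.
    have h2 : Complex.exp (c * a) = Complex.exp (c * (-a : ℝ)) := by
      refine Complex.exp_eq_exp_iff_exists_int.mpr ⟨n, ?_⟩
      rw [hc]
      push_cast
      field_simp
      ring
    rw [h2]
    simp

theorem integral_boxBasis_mul_conj {a : ℝ} (ha : 0 < a) {d : ℕ} (h k : Fin d → ℤ) :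
    ∫ x in box a d, boxBasis a h x * conj (boxBasis a k x) = if h = k then 1 else 0 := by
  have hs : ((1 / Real.sqrt (2 * a) : ℝ) : ℂ) * ((1 / Real.sqrt (2 * a) : ℝ) : ℂ) *
      (2 * (a : ℂ)) = 1 := by
    have : (1 / Real.sqrt (2 * a)) * (1 / Real.sqrt (2 * a)) * (2 * a) = 1 := by
      rw [div_mul_div_comm, Real.mul_self_sqrt (by linarith)]
      field_simp
    exact_mod_cast this
  have h1 : ∀ x : Fin d → ℝ, boxBasis a h x * conj (boxBasis a k x) =
      ∏ j, (((1 / Real.sqrt (2 * a) : ℝ) : ℂ) * ((1 / Real.sqrt (2 * a) : ℝ) : ℂ)) *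
        Complex.exp (2 * Real.pi * Complex.I * ((h j - k j : ℤ) : ℂ) *
          (((x j + a) / (2 * a) : ℝ) : ℂ)) := by
    intro x
    unfold boxBasis
    rw [map_prod, ← Finset.prod_mul_distrib]
    refine Finset.prod_congr rfl fun j _ => ?_
    rw [map_mul, Complex.conj_ofReal, ← Complex.exp_conj, mul_mul_mul_comm, ← Complex.exp_add]
    congr 2
    simp only [map_mul, Complex.conj_I, Complex.conj_ofReal, map_ofNat, Int.cast_sub, map_intCast]
    ring
  have hbox : box a d = Set.univ.pi fun _ => Set.Icc (-a) a := by
    rw [Set.pi_univ_Icc]; rfl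
  simp_rw [h1]
  rw [hbox, volume_pi, Measure.restrict_pi_pi, integral_fintype_prod_eq_prod (𝕜 := ℂ)
    (fun (j : Fin d) (t : ℝ) => (((1 / Real.sqrt (2 * a) : ℝ) : ℂ) *
      ((1 / Real.sqrt (2 * a) : ℝ) : ℂ)) * Complex.exp (2 * Real.pi * Complex.I *
        ((h j - k j : ℤ) : ℂ) * (((t + a) / (2 * a) : ℝ) : ℂ)))]
  have h2 : ∀ j, ∫ t in Set.Icc (-a) a, (((1 / Real.sqrt (2 * a) : ℝ) : ℂ) *
      ((1 / Real.sqrt (2 * a) : ℝ) : ℂ)) * Complex.exp (2 * Real.pi * Complex.I *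
        ((h j - k j : ℤ) : ℂ) * (((t + a) / (2 * a) : ℝ) : ℂ)) = if h j = k j then 1 else 0 := by
    intro j
    rw [integral_const_mul, integral_exp_box ha]
    simp only [sub_eq_zero]
    split_ifs
    · exact hs
    · simp
  simp_rw [h2]
  split_ifs with hk
  · simp [hk]
  · obtain ⟨j, hj⟩ := Function.ne_iff.mp hk
    exact Finset.prod_eq_zero (Finset.mem_univ j) (if_neg hj)

theorem summable_norm_mul_boxBasis (a : ℝ) {d : ℕ} {c : (Fin d → ℤ) → ℂ}
    (hc : Summable fun h => ‖c h‖) (x : Fin d → ℝ) :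
    Summable fun h => ‖c h * boxBasis a h x‖ := by
  simp_rw [norm_mul, norm_boxBasis]
  exact hc.mul_right _

theorem isCompact_box (a : ℝ) (d : ℕ) : IsCompact (box a d) := isCompact_Icc

theorem measurableSet_box (a : ℝ) (d : ℕ) : MeasurableSet (box a d) := measurableSet_Icc

/-- Parseval's identity for absolutely convergent Fourier series on the box. -/
theorem lintegral_tsum_mul_boxBasis {a : ℝ} (ha : 0 < a) {d : ℕ} {c : (Fin d → ℤ) → ℂ}
    (hc : Summable fun h => ‖c h‖) :
    ∫⁻ x in box a d, ‖∑' h, c h * boxBasis a h x‖ₑ ^ 2 = ∑' h, ‖c h‖ₑ ^ 2 := by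
  classical
  set F : (Fin d → ℝ) → ℂ := fun x => ∑' h, c h * boxBasis a h x with hF
  have hFc : Continuous F := by
    refine continuous_tsum (u := fun h => ‖c h‖ * (1 / Real.sqrt (2 * a)) ^ d)
      (fun h => continuous_const.mul (continuous_boxBasis a h)) (hc.mul_right _) fun h x => ?_
    rw [norm_mul, norm_boxBasis]
  -- `|F|²` is expanded into a double series. Each `‖G p x‖` is constant in `x` and summable in `p`,
  -- so sum and integral commute, and orthonormality leaves the diagonal.
  let G : (Fin d → ℤ) × (Fin d → ℤ) → (Fin d → ℝ) → ℂ := fun p x =>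
    (c p.1 * boxBasis a p.1 x) * conj (c p.2 * boxBasis a p.2 x)
  have hGc : ∀ p, Continuous (G p) := fun p =>
    (continuous_const.mul (continuous_boxBasis a _)).mul
      (Complex.continuous_conj.comp (continuous_const.mul (continuous_boxBasis a _)))
  have hcc : Summable fun p : (Fin d → ℤ) × (Fin d → ℤ) => ‖c p.1‖ * ‖c p.2‖ :=
    hc.mul_of_nonneg hc (fun _ => norm_nonneg _) fun _ => norm_nonneg _
  have h1 := hasSum_integral_of_summable_integral_norm (μ := volume.restrict (box a d)) (F := G)
    (fun p => (hGc p).continuousOn.integrableOn_compact (isCompact_box a d)) (by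
      have : ∀ p x, ‖G p x‖ = ‖c p.1‖ * ‖c p.2‖ *
          ((1 / Real.sqrt (2 * a)) ^ d * (1 / Real.sqrt (2 * a)) ^ d) := by
        intro p x
        simp only [G, norm_mul, RCLike.norm_conj, norm_boxBasis]
        ring
      simp_rw [this, integral_const]
      exact (hcc.mul_right _).const_smul _)
  have h2 : ∀ x, ∑' p, G p x = ((‖F x‖ ^ 2 : ℝ) : ℂ) := by
    intro x
    have hs := summable_norm_mul_boxBasis a hc x
    have hs' : Summable fun h => ‖conj (c h * boxBasis a h x)‖ := by simpa using hs
    rw [← tsum_mul_tsum_of_summable_norm hs hs', ← Complex.conj_tsum]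
    push_cast
    exact Complex.mul_conj' _
  have h3 : ∀ p, ∫ x in box a d, G p x = if p.1 = p.2 then ((‖c p.1‖ ^ 2 : ℝ) : ℂ) else 0 := by
    intro p
    have : ∀ x, G p x = (c p.1 * conj (c p.2)) * (boxBasis a p.1 x * conj (boxBasis a p.2 x)) := by
      intro x
      simp only [G, map_mul]
      ring
    simp_rw [this]
    rw [integral_const_mul, integral_boxBasis_mul_conj ha]
    split_ifs with h
    · rw [h, mul_one, Complex.mul_conj']
      push_cast
      rfl
    · simp
  simp_rw [h2, h3] at h1
  rw [integral_complex_ofReal] at h1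
  have hinj : Function.Injective fun h : Fin d → ℤ => (h, h) := fun h k hk => (Prod.ext_iff.mp hk).1
  rw [← hinj.hasSum_iff] at h1
  · have h4 : HasSum (fun h => ‖c h‖ ^ 2) (∫ x in box a d, ‖F x‖ ^ 2) := by
      rw [← Complex.hasSum_ofReal]
      simpa [Function.comp_def] using h1
    have h5 := ofReal_integral_eq_lintegral_ofReal (μ := volume.restrict (box a d))
      (f := fun x => ‖F x‖ ^ 2)
      ((hFc.norm.pow 2).continuousOn.integrableOn_compact (isCompact_box a d))
      (Filter.Eventually.of_forall fun x => by positivity)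
    have h6 : ∀ w : ℂ, ‖w‖ₑ ^ 2 = ENNReal.ofReal (‖w‖ ^ 2) := fun w => by
      rw [ENNReal.ofReal_pow (norm_nonneg _), ofReal_norm]
    simp_rw [h6]
    rw [← h5, ← h4.tsum_eq, ENNReal.ofReal_tsum_of_nonneg (fun _ => by positivity) h4.summable]
  · rintro ⟨h, k⟩ hk
    refine if_neg fun h' => hk ⟨h, ?_⟩
    simp only at h'
    rw [h']

/-! ### Lattice rules and aliasing -/

/-- Dropping the fractional parts changes the exponent by an integer multiple of `2πi`. -/
theorem cubeBasis_latticePoint {N : ℕ} {d : ℕ} (z : Fin d → ℕ) (n : Fin d → ℤ) (k : ℕ) :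
    cubeBasis n (latticePoint N z k) =
      Complex.exp (2 * Real.pi * Complex.I * (((∑ j, n j * (z j : ℤ) : ℤ) : ℂ) / N)) ^ k := by
  unfold cubeBasis latticePoint
  rw [← Complex.exp_nat_mul]
  refine Complex.exp_eq_exp_iff_exists_int.mpr
    ⟨-∑ j, n j * ⌊(k : ℝ) * (z j : ℝ) / (N : ℝ)⌋, ?_⟩
  have h1 : ∀ j, ((Int.fract ((k : ℝ) * (z j : ℝ) / (N : ℝ)) : ℝ) : ℂ) =
      (k : ℂ) * (z j : ℂ) / (N : ℂ) - (⌊(k : ℝ) * (z j : ℝ) / (N : ℝ)⌋ : ℂ) := by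
    intro j
    rw [Int.fract]
    push_cast
    rfl
  push_cast
  simp_rw [h1, mul_sub, Finset.sum_sub_distrib]
  have h2 : ∑ j, (n j : ℂ) * ((k : ℂ) * (z j : ℂ) / (N : ℂ)) =
      k * ((∑ j, (n j : ℂ) * (z j : ℂ)) / N) := by
    rw [Finset.sum_div, Finset.mul_sum]
    exact Finset.sum_congr rfl fun j _ => by ring
  rw [h2]
  ring

/-- A geometric sum of powers of an `N`-th root of unity, which equals `1` exactly when `n` is in
the dual lattice. -/
theorem sum_cubeBasis_latticePoint {N : ℕ} (hN : 0 < N) {d : ℕ} (z : Fin d → ℕ)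
    (n : Fin d → ℤ) [Decidable (InDual N z n)] :
    (1 / (N : ℂ)) * ∑ k ∈ Finset.Icc 1 N, cubeBasis n (latticePoint N z k) =
      if InDual N z n then 1 else 0 := by
  have hN' : (N : ℂ) ≠ 0 := by exact_mod_cast hN.ne'
  simp_rw [cubeBasis_latticePoint]
  set t : ℤ := ∑ j, n j * (z j : ℤ) with ht
  set w : ℂ := Complex.exp (2 * Real.pi * Complex.I * ((t : ℂ) / N)) with hw
  have h2pi : 2 * (Real.pi : ℂ) * Complex.I ≠ 0 := Complex.two_pi_I_ne_zero
  have hw1 : w = 1 ↔ InDual N z n := by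
    rw [hw, Complex.exp_eq_one_iff]
    constructor
    · rintro ⟨m, hm⟩
      rw [mul_comm] at hm
      have := mul_right_cancel₀ h2pi hm
      rw [div_eq_iff hN', mul_comm] at this
      exact ⟨m, by exact_mod_cast this⟩
    · rintro ⟨m, hm⟩
      refine ⟨m, ?_⟩
      rw [ht, hm]
      push_cast
      field_simp
  split_ifs with h
  · rw [hw1.mpr h]
    simp [hN']
  · have hne : w ≠ 1 := mt hw1.mp h
    have hwN : w ^ N = 1 := by
      rw [hw, ← Complex.exp_nat_mul, Complex.exp_eq_one_iff]
      exact ⟨t, by field_simp⟩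
    have : ∑ k ∈ Finset.Icc 1 N, w ^ k = 0 := by
      rw [← Finset.Ico_succ_right_eq_Icc, geom_sum_Ico hne (by simp)]
      simp [pow_succ, hwN]
    rw [this, mul_zero]

theorem latticePoint_mem (N : ℕ) {d : ℕ} (z : Fin d → ℕ) (k : ℕ) {a : ℝ} (ha : 0 < a) :
    scaling a (latticePoint N z k) ∈ box a d := by
  refine ⟨fun j => ?_, fun j => ?_⟩
  · have := Int.fract_nonneg ((k : ℝ) * (z j : ℝ) / (N : ℝ))
    simp only [scaling, latticePoint]
    nlinarith
  · have := (Int.fract_lt_one ((k : ℝ) * (z j : ℝ) / (N : ℝ))).le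
    simp only [scaling, latticePoint]
    nlinarith

theorem scalingInv_scaling {a : ℝ} (ha : a ≠ 0) {d : ℕ} (y : Fin d → ℝ) :
    scalingInv a (scaling a y) = y := by
  funext j
  simp only [scaling, scalingInv]
  field_simp
  ring

/-- The lattice rule approximations of Fourier coefficients are sums over the dual lattice. -/
theorem latticeCoeff_eq {N : ℕ} (hN : 0 < N) {a : ℝ} (ha : 0 < a) {d : ℕ} (z : Fin d → ℕ)
    {φ : (Fin d → ℝ) → ℂ} {c : (Fin d → ℤ) → ℂ}
    (hφ : ∀ x ∈ box a d, HasSum (fun h => c h * boxBasis a h x) (φ x)) (h : Fin d → ℤ)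
    [DecidablePred (InDual N z)] :
    HasSum (fun l => ((1 / Real.sqrt (2 * a) : ℝ) : ℂ) ^ d *
      if InDual N z l then c (h + l) else 0) (latticeCoeff N z (φ ∘ scaling a) h) := by
  have h1 : ∀ k ∈ Finset.Icc 1 N, HasSum (fun m => (c m * boxBasis a m
      (scaling a (latticePoint N z k))) * conj (cubeBasis h (latticePoint N z k)))
      ((φ ∘ scaling a) (latticePoint N z k) * conj (cubeBasis h (latticePoint N z k))) :=
    fun k _ => (hφ _ (latticePoint_mem N z k ha)).mul_right _
  have h2 := (hasSum_sum h1).mul_left (1 / (N : ℂ))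
  rw [← (Equiv.addLeft h).hasSum_iff] at h2
  refine h2.congr_fun fun l => ?_
  simp only [Function.comp_apply, Equiv.coe_addLeft, boxBasis_eq_mul_cubeBasis,
    scalingInv_scaling ha.ne']
  have h3 : ∀ k, c (h + l) * (((1 / Real.sqrt (2 * a) : ℝ) : ℂ) ^ d *
      cubeBasis (h + l) (latticePoint N z k)) * conj (cubeBasis h (latticePoint N z k)) =
      (c (h + l) * ((1 / Real.sqrt (2 * a) : ℝ) : ℂ) ^ d) *
        cubeBasis l (latticePoint N z k) := by
    intro k
    have := cubeBasis_mul_conj (h + l) h (latticePoint N z k)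
    rw [add_sub_cancel_left] at this
    rw [← this]
    ring
  simp_rw [h3]
  rw [← Finset.mul_sum, mul_left_comm, sum_cubeBasis_latticePoint hN]
  split_ifs <;> ring

/-! ### The error of the lattice algorithm -/

/-- The aliasing error of the lattice rule in the Fourier coefficient with index `h`. -/
noncomputable def aliasCoeff (N : ℕ) {d : ℕ} (z : Fin d → ℕ) (c : (Fin d → ℤ) → ℂ)
    (h : Fin d → ℤ) : ℂ :=
  open Classical in ∑' l : Fin d → ℤ, if l ≠ 0 ∧ InDual N z l then c (h + l) else 0

/-- The Fourier coefficients of the error of the lattice algorithm that truncates to `T`. -/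
noncomputable def errorCoeff (N : ℕ) {d : ℕ} (z : Fin d → ℕ) (T : Set (Fin d → ℤ))
    (c : (Fin d → ℤ) → ℂ) (h : Fin d → ℤ) : ℂ :=
  open Classical in if h ∈ T then -aliasCoeff N z c h else c h

theorem latticeCoeff_eq_add_aliasCoeff {N : ℕ} (hN : 0 < N) {a : ℝ} (ha : 0 < a) {d : ℕ}
    (z : Fin d → ℕ) {φ : (Fin d → ℝ) → ℂ} {c : (Fin d → ℤ) → ℂ}
    (hφ : ∀ x ∈ box a d, HasSum (fun h => c h * boxBasis a h x) (φ x))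
    (hc : Summable fun h => ‖c h‖) (h : Fin d → ℤ) :
    latticeCoeff N z (φ ∘ scaling a) h =
      ((1 / Real.sqrt (2 * a) : ℝ) : ℂ) ^ d * (c h + aliasCoeff N z c h) := by
  classical
  rw [← (latticeCoeff_eq hN ha z hφ h).tsum_eq, tsum_mul_left]
  congr 1
  have hs : Summable fun l : Fin d → ℤ => c (h + l) :=
    (Equiv.addLeft h).summable_iff.mpr hc.of_norm
  have hs' : Summable fun l : Fin d → ℤ => if InDual N z l then c (h + l) else 0 :=
    (hs.indicator {l | InDual N z l}).congr fun l => by simp [Set.indicator_apply]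
  rw [hs'.tsum_eq_add_tsum_ite 0]
  congr 1
  · simp [InDual]
  · unfold aliasCoeff
    refine tsum_congr fun l => ?_
    by_cases hl : l = 0 <;> simp [hl]

theorem hasSum_errorCoeff {α N : ℕ} (hN : 0 < N) {a : ℝ} (ha : 0 < a) {d : ℕ}
    (z : Fin d → ℕ) {φ : (Fin d → ℝ) → ℂ} {c : (Fin d → ℤ) → ℂ}
    (hφ : ∀ x ∈ box a d, HasSum (fun h => c h * boxBasis a h x) (φ x))
    (hc : Summable fun h => ‖c h‖) {T : Set (Fin d → ℤ)} (hT : T.Finite)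
    (hTα : T = truncationSet α (1 / Real.sqrt (latticeCriterion α N z)) d)
    {x : Fin d → ℝ} (hx : x ∈ box a d) :
    HasSum (fun h => errorCoeff N z T c h * boxBasis a h x)
      (φ x - scaledLatticeAlgorithm α a N z φ x) := by
  classical
  have h1 : scaledLatticeAlgorithm α a N z φ x =
      ∑ h ∈ hT.toFinset, (c h + aliasCoeff N z c h) * boxBasis a h x := by
    unfold scaledLatticeAlgorithm
    rw [Function.comp_apply]
    unfold latticeAlgorithm
    rw [← hTα, finsum_mem_eq_finite_toFinset_sum _ hT]
    refine Finset.sum_congr rfl fun h _ => ?_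
    rw [latticeCoeff_eq_add_aliasCoeff hN ha z hφ hc, boxBasis_eq_mul_cubeBasis]
    ring
  have h2 : HasSum (fun h => if h ∈ T then (c h + aliasCoeff N z c h) * boxBasis a h x else 0)
      (scaledLatticeAlgorithm α a N z φ x) := by
    rw [h1, Finset.sum_congr rfl (g := fun h =>
      if h ∈ T then (c h + aliasCoeff N z c h) * boxBasis a h x else 0)
      fun h hh => by rw [if_pos (hT.mem_toFinset.mp hh)]]
    exact hasSum_sum_of_ne_finset_zero fun h hh => if_neg (by simpa using hh)
  refine ((hφ x hx).sub h2).congr_fun fun h => ?_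
  unfold errorCoeff
  split_ifs <;> ring

theorem summable_norm_errorCoeff (N : ℕ) {d : ℕ} (z : Fin d → ℕ) {c : (Fin d → ℤ) → ℂ}
    (hc : Summable fun h => ‖c h‖) {T : Set (Fin d → ℤ)} (hT : T.Finite) :
    Summable fun h => ‖errorCoeff N z T c h‖ := by
  refine (summable_congr_cofinite ?_).mp hc
  filter_upwards [hT.compl_mem_cofinite] with h hh
  rw [errorCoeff, if_neg hh]

/-- Cauchy–Schwarz after inserting `r(h+ℓ)⁻¹ r(h+ℓ)`; the second factor is enlarged to the full
weighted norm by translation. -/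
theorem enorm_aliasCoeff_sq_le (α N : ℕ) {d : ℕ} (z : Fin d → ℕ) {c : (Fin d → ℤ) → ℂ}
    (h : Fin d → ℤ) [DecidablePred (InDual N z)] :
    ‖aliasCoeff N z c h‖ₑ ^ 2 ≤
      (∑' l : Fin d → ℤ, if l ≠ 0 ∧ InDual N z l then
        ∏ j, powWeight (2 * α) (h j + l j) else 0) *
      ∑' h : Fin d → ℤ, ENNReal.ofReal (‖c h‖ ^ 2 * cubeWeight α h ^ 2) := by
  classical
  have hE : ∑' l : Fin d → ℤ, ENNReal.ofReal (‖c (h + l)‖ * cubeWeight α (h + l)) ^ 2 =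
      ∑' h : Fin d → ℤ, ENNReal.ofReal (‖c h‖ ^ 2 * cubeWeight α h ^ 2) := by
    rw [← (Equiv.addLeft h).tsum_eq
      fun h => ENNReal.ofReal (‖c h‖ ^ 2 * cubeWeight α h ^ 2)]
    refine tsum_congr fun l => ?_
    rw [← ENNReal.ofReal_pow (mul_nonneg (norm_nonneg _) (cubeWeight_pos α _).le), mul_pow]
    rfl
  have hle : ‖aliasCoeff N z c h‖ₑ ≤ ∑' l : Fin d → ℤ,
      (if l ≠ 0 ∧ InDual N z l then ENNReal.ofReal (1 / cubeWeight α (h + l)) else 0) *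
        ENNReal.ofReal (‖c (h + l)‖ * cubeWeight α (h + l)) := by
    unfold aliasCoeff
    refine (enorm_tsum_le_tsum_enorm).trans (ENNReal.tsum_le_tsum fun l => ?_)
    have hw := cubeWeight_pos α (h + l)
    split_ifs
    · rw [← ENNReal.ofReal_mul (by positivity), ← ofReal_norm]
      refine (congrArg ENNReal.ofReal ?_).le
      field_simp
    · simp
  refine (pow_le_pow_left' hle 2).trans ((tsum_mul_sq_le _ _).trans_eq ?_)
  rw [hE]
  congr 1
  refine tsum_congr fun l => ?_
  have hw := cubeWeight_pos α (h + l)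
  split_ifs
  · rw [← ENNReal.ofReal_pow (by positivity), one_div_pow, ofReal_one_div_cubeWeight_sq]
    rfl
  · simp

theorem tsum_errorCoeff_le {α N : ℕ} {d : ℕ} (z : Fin d → ℕ) (c : (Fin d → ℤ) → ℂ)
    {M : ℝ} (hM : 0 < M) :
    ∑' h, ‖errorCoeff N z (truncationSet α M d) c h‖ₑ ^ 2 ≤
      (ENNReal.ofReal (1 / M) +
        ENNReal.ofReal M * dualSum N (powWeight (2 * α)) (fun l => l ≠ 0) z) *
      ∑' h : Fin d → ℤ, ENNReal.ofReal (‖c h‖ ^ 2 * cubeWeight α h ^ 2) := by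
  classical
  set E := ∑' h : Fin d → ℤ, ENNReal.ofReal (‖c h‖ ^ 2 * cubeWeight α h ^ 2) with hE
  have h1 : ∀ h, ‖errorCoeff N z (truncationSet α M d) c h‖ₑ ^ 2 ≤
      ENNReal.ofReal (1 / M) * ENNReal.ofReal (‖c h‖ ^ 2 * cubeWeight α h ^ 2) +
        ENNReal.ofReal M * ((∏ j, powWeight (2 * α) (h j)) *
          (∑' l : Fin d → ℤ, if l ≠ 0 ∧ InDual N z l then
            ∏ j, powWeight (2 * α) (h j + l j) else 0)) * E := by
    intro h
    have hw := cubeWeight_pos α h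
    unfold errorCoeff
    split_ifs with hh
    · refine le_trans ?_ le_add_self
      rw [enorm_neg]
      refine (enorm_aliasCoeff_sq_le α N z h).trans (mul_le_mul_left ?_ _)
      -- Inside the truncation set `1 ≤ M / r(h)²`, which brings in the missing weight of `h`.
      rw [← mul_assoc]
      refine le_mul_of_one_le_left zero_le ?_
      rw [← ofReal_one_div_cubeWeight_sq, ← ENNReal.ofReal_mul hM.le, ENNReal.one_le_ofReal,
        mul_one_div, one_le_div (by positivity)]
      exact hh
    · refine le_trans ?_ le_self_add
      rw [← ofReal_norm, ← ENNReal.ofReal_pow (norm_nonneg _),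
        ← ENNReal.ofReal_mul (by positivity)]
      refine ENNReal.ofReal_le_ofReal ?_
      have hlt : M ≤ cubeWeight α h ^ 2 := (not_le.mp hh).le
      rw [one_div_mul_eq_div, le_div_iff₀ hM]
      gcongr
  refine (ENNReal.tsum_le_tsum h1).trans_eq ?_
  rw [ENNReal.tsum_add, ENNReal.tsum_mul_left, ENNReal.tsum_mul_right, ENNReal.tsum_mul_left,
    ← hE, add_mul]
  congr 3
  unfold dualSum
  refine tsum_congr fun h => ?_
  rw [← ENNReal.tsum_mul_left]
  refine tsum_congr fun l => ?_
  split_ifs <;> simp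

/-- Factorwise: equality when `h j ≠ 0`, and `1 ≤ (2a)^α √(2a)` when `h j = 0`, which is where `a ≥
1/2` enters. -/
theorem cubeWeight_le_boxWeight (α : ℕ) {a : ℝ} (ha : 1 / 2 ≤ a) {d : ℕ} (h : Fin d → ℤ) :
    cubeWeight α h ≤ (2 * a) ^ (α * d) * boxWeight α a h := by
  have ha0 : 0 < a := by linarith
  unfold cubeWeight boxWeight
  have h1 : (2 * a) ^ (α * d) = ∏ _j : Fin d, (2 * a) ^ α := by
    rw [Finset.prod_const, Finset.card_univ, Fintype.card_fin, pow_mul]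
  rw [h1, ← Finset.prod_mul_distrib]
  refine Finset.prod_le_prod (fun j _ => (cubeWeight_factor_pos α (h j)).le) fun j _ => ?_
  split_ifs
  · exact one_le_mul_of_one_le_of_one_le (one_le_pow₀ (by linarith))
      (Real.one_le_sqrt.mpr (by linarith))
  · have h2 : 2 * Real.pi * (h j : ℝ) = 2 * a * (Real.pi * (h j : ℝ) / a) := by field_simp
    rw [← mul_pow, h2, abs_mul (2 * a), abs_of_pos (by linarith : 0 < 2 * a)]

theorem tsum_ofReal_cubeWeight_le {α : ℕ} {a : ℝ} (ha : 1 / 2 ≤ a) {d : ℕ}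
    {φ : (Fin d → ℝ) → ℂ} (hφ : MemKorobovBox α a φ) :
    ∑' h : Fin d → ℤ, ENNReal.ofReal (‖boxCoeff a φ h‖ ^ 2 * cubeWeight α h ^ 2) ≤
      ENNReal.ofReal ((korobovBoxNorm α a φ * (2 * a) ^ (α * d)) ^ 2) := by
  have hnn : ∀ h : Fin d → ℤ, 0 ≤ ‖boxCoeff a φ h‖ ^ 2 * boxWeight α a h ^ 2 :=
    fun h => by positivity
  have h1 : (korobovBoxNorm α a φ * (2 * a) ^ (α * d)) ^ 2 = ((2 * a) ^ (α * d)) ^ 2 *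
      ∑' h : Fin d → ℤ, ‖boxCoeff a φ h‖ ^ 2 * boxWeight α a h ^ 2 := by
    rw [korobovBoxNorm, mul_pow, Real.sq_sqrt (tsum_nonneg hnn), mul_comm]
  rw [h1, ENNReal.ofReal_mul (by positivity), ENNReal.ofReal_tsum_of_nonneg hnn hφ.2,
    ← ENNReal.tsum_mul_left]
  refine ENNReal.tsum_le_tsum fun h => ?_
  rw [← ENNReal.ofReal_mul (by positivity)]
  refine ENNReal.ofReal_le_ofReal ?_
  have h2 := pow_le_pow_left₀ (cubeWeight_pos α h).le (cubeWeight_le_boxWeight α ha h) 2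
  refine (mul_le_mul_of_nonneg_left h2 (by positivity)).trans_eq ?_
  ring

/-- Convergence at the single point `0` suffices, because `‖boxBasis a h x‖` does not depend on `h`.
-/
theorem MemKorobovBox.summable_norm_boxCoeff {α : ℕ} {a : ℝ} (ha : 0 < a) {d : ℕ}
    {φ : (Fin d → ℝ) → ℂ} (hφ : MemKorobovBox α a φ) :
    Summable fun h : Fin d → ℤ => ‖boxCoeff a φ h‖ := by
  have h1 := (hφ.1 0 ⟨fun _ => by simpa using ha.le, fun _ => ha.le⟩).summable.norm
  simp_rw [norm_mul, norm_boxBasis] at h1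
  have : (1 / Real.sqrt (2 * a)) ^ d ≠ 0 := by positivity
  exact (summable_mul_right_iff this).mp h1

/-- The error of the scaled lattice algorithm in terms of the quality criterion. -/
theorem eLpNorm_sub_scaledLatticeAlgorithm_le {α N : ℕ} (hα : 1 ≤ α) (hN : 0 < N) {d : ℕ}
    (hd : 1 ≤ d) (z : Fin d → ℕ) {a : ℝ} (ha : 1 / 2 ≤ a) {φ : (Fin d → ℝ) → ℂ}
    (hφ : MemKorobovBox α a φ) :
    eLpNorm (fun x => φ x - scaledLatticeAlgorithm α a N z φ x) 2 (volume.restrict (box a d)) ≤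
      ENNReal.ofReal (Real.sqrt 2 * latticeCriterion α N z ^ (1 / 4 : ℝ) *
        (korobovBoxNorm α a φ * (2 * a) ^ (α * d))) := by
  have ha0 : 0 < a := by linarith
  have hS := latticeCriterion_pos hα hN hd z
  set S := latticeCriterion α N z with hSdef
  have hM : 0 < 1 / Real.sqrt S := by positivity
  have hT := truncationSet_finite α hα (1 / Real.sqrt S) d
  have hc := hφ.summable_norm_boxCoeff ha0
  have hF : 0 ≤ korobovBoxNorm α a φ * (2 * a) ^ (α * d) := by
    unfold korobovBoxNorm
    positivity
  have hdual : dualSum N (powWeight (2 * α)) (fun l => l ≠ 0) z = ENNReal.ofReal S := by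
    rw [hSdef, latticeCriterion_eq hα,
      ENNReal.ofReal_toReal (dualSum_ne_top N (one_lt_two_mul_cast hα) _ z)]
  have hsq : ∫⁻ x in box a d, ‖φ x - scaledLatticeAlgorithm α a N z φ x‖ₑ ^ 2 ≤
      ENNReal.ofReal (Real.sqrt 2 * S ^ (1 / 4 : ℝ) *
        (korobovBoxNorm α a φ * (2 * a) ^ (α * d))) ^ 2 := by
    rw [setLIntegral_congr_fun (measurableSet_box a d) (g := fun x =>
      ‖∑' h, errorCoeff N z (truncationSet α (1 / Real.sqrt S) d) (boxCoeff a φ) h *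
        boxBasis a h x‖ₑ ^ 2) fun x hx => by
        simp only [(hasSum_errorCoeff hN ha0 z hφ.1 hc hT rfl hx).tsum_eq],
      lintegral_tsum_mul_boxBasis ha0 (summable_norm_errorCoeff N z hc hT)]
    refine (tsum_errorCoeff_le z _ hM).trans
      ((mul_le_mul_right (tsum_ofReal_cubeWeight_le ha hφ) _).trans_eq ?_)
    rw [hdual, ← ENNReal.ofReal_mul hM.le, ← ENNReal.ofReal_add (by positivity) (by positivity),
      ← ENNReal.ofReal_mul (by positivity), ← ENNReal.ofReal_pow (by positivity)]
    congr 1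
    have h4 : (S ^ (1 / 4 : ℝ)) ^ 2 = Real.sqrt S := by
      rw [← Real.rpow_natCast, ← Real.rpow_mul hS.le, Real.sqrt_eq_rpow]
      norm_num
    -- With `M = 1/√S` both terms of `1/M + M S` equal `√S`.
    rw [mul_pow _ (korobovBoxNorm α a φ * _), mul_pow (Real.sqrt 2), h4,
      Real.sq_sqrt zero_le_two, one_div_one_div, one_div_mul_eq_div, Real.div_sqrt,
      ← two_mul (Real.sqrt S)]
  rw [eLpNorm_eq_lintegral_rpow_enorm_toReal two_ne_zero ENNReal.ofNat_ne_top]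
  simp only [ENNReal.toReal_ofNat, ENNReal.rpow_two]
  rw [one_div 2, ENNReal.rpow_inv_le_iff two_pos, ENNReal.rpow_two]
  exact hsq

/-! ### The constant -/

/-- Split `(1+m)^(2d-1)` as `(1+m)^(d-1) (1+m)^d`. Then `d m (1+m)^(d-1) = ∑ |u| m^|u|` and `(1+m)^d
= ∑ m^|u|`, and `max(|u|,1)` dominates both coefficients. -/
theorem card_mul_pow_le_sum (d : ℕ) {m : ℝ} (hm : 0 ≤ m) :
    d * m * (1 + m) ^ (2 * d - 1) ≤
      (∑ u : Finset (Fin d), ((max u.card 1 : ℕ) : ℝ) * m ^ u.card) ^ 2 := by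
  have h1 : (1 + m) ^ d ≤ ∑ u : Finset (Fin d), ((max u.card 1 : ℕ) : ℝ) * m ^ u.card := by
    have := Fintype.sum_pow_mul_eq_add_pow (Fin d) m 1
    rw [Fintype.card_fin, add_comm m 1] at this
    rw [← this]
    refine Finset.sum_le_sum fun u _ => ?_
    rw [one_pow, mul_one]
    refine le_mul_of_one_le_left (by positivity) ?_
    exact_mod_cast le_max_right _ _
  have h2 : d * m * (1 + m) ^ (d - 1) ≤
      ∑ u : Finset (Fin d), ((max u.card 1 : ℕ) : ℝ) * m ^ u.card := by
    have h3 : ∑ u : Finset (Fin d), (u.card : ℝ) * m ^ u.card = d * m * (1 + m) ^ (d - 1) := by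
      rw [← Finset.powerset_univ, Finset.sum_powerset_apply_card (fun k => (k : ℝ) * m ^ k),
        Finset.card_univ, Fintype.card_fin]
      rcases d with _ | n
      · simp
      · rw [Finset.sum_range_succ', add_tsub_cancel_right, add_comm 1 m, add_pow, Finset.mul_sum]
        simp only [CharP.cast_eq_zero, zero_mul, smul_zero, add_zero, nsmul_eq_mul]
        refine Finset.sum_congr rfl fun k _ => ?_
        have h4 : ((n : ℝ) + 1) * (n.choose k : ℝ) = ((n + 1).choose (k + 1) : ℝ) * (k + 1) := by
          exact_mod_cast Nat.add_one_mul_choose_eq n k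
        rw [one_pow, pow_succ]
        push_cast
        linear_combination (-(m ^ k * m)) * h4
    rw [← h3]
    refine Finset.sum_le_sum fun u _ => mul_le_mul_of_nonneg_right ?_ (by positivity)
    exact_mod_cast le_max_left _ _
  rcases Nat.eq_zero_or_pos d with rfl | hd
  · simpa using sq_nonneg _
  · rw [sq, show 2 * d - 1 = (d - 1) + d by omega, pow_add, ← mul_assoc]
    exact mul_le_mul h2 h1 (by positivity) (by positivity)

theorem div_mul_sq_rpow {K W x : ℝ} (hK : 0 ≤ K) (hW : 0 ≤ W) (hx : 0 < x) (q : ℝ) :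
    (K / x * W ^ 2) ^ q = K ^ q * W ^ (2 * q) * x ^ (-q) := by
  rw [Real.mul_rpow (by positivity) (by positivity), Real.div_rpow hK hx.le,
    ← Real.rpow_natCast W 2, ← Real.rpow_mul hW, Real.rpow_neg hx.le]
  push_cast
  ring

/-- With `q = α/2 - δ`, the choice `p = 1/(4q)` gives `2αp = α/(α-2δ) > 1`, and raising the bound on
`S^p` to the power `q` yields `S^(1/4)`. -/
theorem IsCBC.sqrt_two_mul_latticeCriterion_rpow_le {α : ℕ} (hα : 1 ≤ α) {N : ℕ} (hN : N.Prime)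
    {d : ℕ} {z : Fin d → ℕ} (hz : IsCBC α N z) {δ : ℝ} (hδ : 0 < δ)
    (hδ' : δ ≤ (α : ℝ) / 2 - 1 / 4) :
    Real.sqrt 2 * latticeCriterion α N z ^ (1 / 4 : ℝ) ≤
      errorConst α δ d * (N : ℝ) ^ (-((α : ℝ) / 2) + δ) := by
  have hαr : (1 : ℝ) ≤ α := by exact_mod_cast hα
  have hpq : ∀ q : ℝ, 0 < q → 1 / (4 * q) * q = 1 / 4 := fun q hq => by field_simp
  have hNr : (0 : ℝ) < N := by exact_mod_cast hN.pos
  set q : ℝ := (α : ℝ) / 2 - δ with hq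
  have hq4 : 1 / 4 ≤ q := by rw [hq]; linarith
  have hq0 : 0 < q := by linarith
  have hq2 : (α : ℝ) - 2 * δ = 2 * q := by rw [hq]; ring
  set β : ℝ := (α : ℝ) / (2 * q) with hβ
  have hβp : 2 * (α : ℝ) * (1 / (4 * q)) = β := by rw [hβ]; field_simp; norm_num
  have hβ1 : 1 < β := by rw [hβ, one_lt_div (by linarith), hq]; linarith
  have hS0 : 0 ≤ latticeCriterion α N z := by
    rw [latticeCriterion_eq hα]; exact ENNReal.toReal_nonneg
  have h1 := hz.latticeCriterion_rpow_le hα hN (p := 1 / (4 * q)) (by positivity)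
    (by rw [div_le_one (by linarith)]; linarith) (by rw [hβp]; exact hβ1)
  rw [hβp] at h1
  set K : ℝ := max 6 (5 / 2 + (2 : ℝ) ^ (2 * (α : ℝ) / ((α : ℝ) - 2 * δ) + 1)) with hK
  set W : ℝ := ∑ u : Finset (Fin d), ((max u.card 1 : ℕ) : ℝ) * zetaMass β ^ u.card with hW
  have hm := zetaMass_nonneg β
  have hW0 : 0 ≤ W := Finset.sum_nonneg fun u _ => by positivity
  have hK0 : 0 ≤ K := le_trans (by norm_num) (le_max_left _ _)
  have hKle : 4 + (2 : ℝ) ^ (β + 1) ≤ K := by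
    -- For `x = 2^β ≥ 2` the claim is `4 + 2x ≤ 5/2 + 2x²`.
    refine le_trans ?_ (le_max_right _ _)
    rw [hq2, mul_div_assoc, ← hβ, Real.rpow_add_one two_ne_zero, Real.rpow_add_one two_ne_zero,
      two_mul β, Real.rpow_add two_pos]
    have : (2 : ℝ) ≤ 2 ^ β := Real.self_le_rpow_of_one_le one_le_two hβ1.le
    nlinarith
  have h2 : latticeCriterion α N z ^ (1 / (4 * q)) ≤ K / N * W ^ 2 :=
    h1.trans (mul_le_mul (by gcongr) (card_mul_pow_le_sum d hm) (by positivity) (by positivity))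
  have h3 : latticeCriterion α N z ^ (1 / 4 : ℝ) ≤ (K / N * W ^ 2) ^ q := by
    have := Real.rpow_le_rpow (by positivity) h2 hq0.le
    rwa [← Real.rpow_mul hS0, hpq q hq0] at this
  have h4 : errorConst α δ d = Real.sqrt 2 * K ^ q * W ^ (2 * q) := by
    unfold errorConst kappa
    rw [← hK, ← hq, hq2, ← hβ]
    rfl
  have h5 := div_mul_sq_rpow hK0 hW0 hNr q
  rw [h4, show -((α : ℝ) / 2) + δ = -q by rw [hq]; ring]
  refine (mul_le_mul_of_nonneg_left (h3.trans_eq h5) (Real.sqrt_nonneg 2)).trans_eq ?_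
  ring

theorem errorConst_nonneg (α : ℕ) (δ : ℝ) (d : ℕ) : 0 ≤ errorConst α δ d := by
  have hz := zetaMass_nonneg ((α : ℝ) / ((α : ℝ) - 2 * δ))
  have hK : (0 : ℝ) ≤ max 6 (5 / 2 + (2 : ℝ) ^ (2 * (α : ℝ) / ((α : ℝ) - 2 * δ) + 1)) :=
    le_trans (by norm_num) (le_max_left _ _)
  unfold errorConst kappa
  refine mul_nonneg (mul_nonneg (Real.sqrt_nonneg 2) (Real.rpow_nonneg hK _))
    (Real.rpow_nonneg (Finset.sum_nonneg fun u _ => ?_) _)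
  exact mul_nonneg (Nat.cast_nonneg _) (pow_nonneg hz _)

end Korobov

theorem proposition3p4 (d α N : ℕ) (hd : 1 ≤ d) (hα : 1 ≤ α) (hN : N.Prime) :
    (∃ z : Fin d → ℕ, Korobov.IsCBC α N z) ∧
    ∀ z : Fin d → ℕ, Korobov.IsCBC α N z →
      ∀ (a : ℝ), 1 / 2 ≤ a → ∀ (φ : (Fin d → ℝ) → ℂ), Korobov.MemKorobovBox α a φ →
        ∀ (δ : ℝ), 0 < δ → δ < (α : ℝ) / 2 →
          eLpNorm (fun x => φ x - Korobov.scaledLatticeAlgorithm α a N z φ x) 2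
              (volume.restrict (Korobov.box a d)) ≤
            ENNReal.ofReal
              (Korobov.errorConst α (min δ ((α : ℝ) / 2 - 1 / 4)) d *
                Korobov.korobovBoxNorm α a φ * (2 * a) ^ (α * d) *
                (N : ℝ) ^ (-((α : ℝ) / 2) + δ)) := by
  refine ⟨Korobov.exists_isCBC α hN d, fun z hz a ha φ hφ δ hδ _ => ?_⟩
  refine (Korobov.eLpNorm_sub_scaledLatticeAlgorithm_le hα hN.pos hd z ha hφ).trans
    (ENNReal.ofReal_le_ofReal ?_)
  have hαr : (1 : ℝ) ≤ α := by exact_mod_cast hα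
  have hδ' : 0 < min δ ((α : ℝ) / 2 - 1 / 4) := lt_min hδ (by linarith)
  have hF : 0 ≤ Korobov.korobovBoxNorm α a φ * (2 * a) ^ (α * d) :=
    mul_nonneg (Real.sqrt_nonneg _) (pow_nonneg (by linarith) _)
  -- The bound is applied at `δ' ≤ δ`, where the rate is at least as good; `δ' > 0` because `α ≥ 1`.
  have hNδ : (N : ℝ) ^ (-((α : ℝ) / 2) + min δ ((α : ℝ) / 2 - 1 / 4)) ≤
      (N : ℝ) ^ (-((α : ℝ) / 2) + δ) :=
    Real.rpow_le_rpow_of_exponent_le (by exact_mod_cast hN.one_le)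
      (add_le_add le_rfl (min_le_left _ _))
  have h1 := (hz.sqrt_two_mul_latticeCriterion_rpow_le hα hN hδ' (min_le_right _ _)).trans
    (mul_le_mul_of_nonneg_left hNδ (Korobov.errorConst_nonneg α _ d))
  refine (mul_le_mul_of_nonneg_right h1 hF).trans_eq ?_
  ring
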